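/- **Multivariate backdoor adjustment.** *Setting.* Let $\mathcal V$ be a finite set of time series; a vertex $V_t$ is the instance of $V\in\mathcal V$ at time $t\in\mathbb Z$, and $V$ takes values in a non-empty countable discrete space. A full-time causal graph (FTCG) $\mathcal G^f$ is an acyclic directed graph on the vertices whose arrows never go back in time. Its summary causal graph (SCG) has vertex set $\mathcal V$ and an arrow $A\to B$ iff $A_{t-\gamma}\to B_t$ in $\mathcal G^f$ for some $t$ and some $\gamma\ge 0$. A dynamic structural causal model with FTCG $\mathcal G^f$ consists of independent exogenous variables $U_v$, one for each vertex (causal sufficiency), measurable structural equations $v=f_v(\mathrm{pa}(v),U_v)$, and a solution of these equations (almost surely) in which each vertex is a measurable function of the exogenous variables of its ancestors, itself included. Its true distribution $P$ is the joint law of the solution. For a finite set $X$ of vertices, $P(\cdot\mid \mathrm{do}(x))$ is the joint law obtained, with the same exogenous variables, by setting the vertices of $X$ to $x$, keeping all other structural equations, and leaving unchanged everything that precedes in time all interventions. *Criterion.* A path is a sequence of distinct vertices, consecutive ones being joined by an arrow of either direction; it is a backdoor path between its first vertex $a$ and its last vertex $b$ if its first arrow points to $a$. It is blocked by $\mathcal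 Z$ if one of its non-colliders is in $\mathcal Z$ or one of its colliders has no descendant in $\mathcal Z$ (a vertex is a descendant of itself). Let $X=\{X^i_{t_i}\}_i$ and $Y=\{Y^j_{t_j}\}_j$ be disjoint finite sets of vertices, and let $\mathcal Z$ be a set of vertices, disjoint from both. $\mathcal Z$ satisfies the multivariate backdoor criterion relative to $X$ and $Y$ in $\mathcal G^f$ if no element of $\mathcal Z$ is a descendant of any $X^i_{t_i}$, and, for all $i,j$, $\mathcal Z$ blocks all backdoor paths between $X^i_{t_i}$ and $Y^j_{t_j}$ in the graph obtained from $\mathcal G^f$ by removing all arrows that leave $X^{i'}_{t_{i'}}$ with $i'\ne i$. *Statement.* Let $\mathcal G^s$ be an SCG, let $\mathcal G^f$ (the true FTCG) be any FTCG with SCG $\mathcal G^s$, and let a dynamic structural causal model with FTCG $\mathcal G^f$ and true distribution $P$ be given. Suppose that $\mathcal Z$ satisfies the multivariate backdoor criterion relative to $X$ and $Y$ in $\mathcal G^f$. Then for all values $x=(x^i_{t_i})_i$ and $y=(y^j_{t_j})_j$ the following holds. 1. If $\mathcal Z$ is finite and $P(x,z)>0$ for every valuation $z$ of $\mathcal Z$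 with $P(z)>0$, then $$P\big((y^j_{t_j})_j \mid (\mathrm{do}(x^i_{t_i}))_i\big)=\sum_z P\big((y^j_{t_j})_j\mid (x^i_{t_i})_i, z\big)\,P(z),$$ where the sum is over all valuations $z$ of $\mathcal Z$ (terms with $P(z)=0$ being $0$). 2. For arbitrary, possibly infinite, $\mathcal Z$: if $P$ is Markov relative to $\mathcal G^f$ (for pairwise disjoint, possibly infinite, sets $A,B,C$ of vertices, if $C$ blocks every path between an element of $A$ and an element of $B$, then $A$ and $B$ are conditionally independent given $C$), and if the law $P_{\mathcal Z}$ of $\mathcal Z$ is absolutely continuous with respect to the law of $\mathcal Z$ conditional on $X=x$, then $$P\big((y^j_{t_j})_j \mid (\mathrm{do}(x^i_{t_i}))_i\big)=\int P\big((y^j_{t_j})_j\mid (x^i_{t_i})_i, z\big)\,dP_{\mathcal Z}(z),$$ where $z\mapsto P(\cdot\mid x,z)$ is the regular conditional law of $Y$ given $\mathcal Z=z$ under $P(\cdot\mid X=x)$. -/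

import Mathlib

open MeasureTheory ProbabilityTheory

namespace CausalTS

/-! ### Paths, blocking and the multivariate backdoor criterion in a directed graph

A directed graph on `α` is a relation `E`, where `E a b` means `a → b`. -/

section Graphs

variable {α : Type*}

/-- `b` is a descendant of `a` (every vertex is a descendant of itself). -/
def IsDesc (E : α → α → Prop) (a b : α) : Prop := Relation.ReflTransGen E a b

/-- The mutilated graph in which all outgoing edges of the vertices of `A` are removed. -/
def removeOut (E : α → α → Prop) (A : Set α) : α → α → Prop :=
  fun a b => E a b ∧ a ∉ A

/-- `π` is a path from `a` to `b`: a sequence of distinct vertices, consecutive ones being joined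
by an arrow of either orientation. -/
structure IsPath (E : α → α → Prop) (a b : α) (π : List α) : Prop where
  nodup : π.Nodup
  chain : π.IsChain (fun u v => E u v ∨ E v u)
  head : π.head? = some a
  last : π.getLast? = some b

/-- `π` is a backdoor path between `a` and `b`: its first arrow points to `a`. -/
def IsBackdoorPath (E : α → α → Prop) (a b : α) (π : List α) : Prop :=
  IsPath E a b π ∧ ∃ c, [a, c] <+: π ∧ E c a

/-- `v` is a collider on `π`: some `u → v ← w` is a subpath of `π`. -/
def IsCollider (E : α → α → Prop) (π : List α) (v : α) : Prop :=
  ∃ u w, [u, v, w] <:+: π ∧ E u v ∧ E w v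

/-- `π` is blocked by `Z`: a non-collider of `π` is in `Z`, or `π` has a collider none of whose
descendants is in `Z`. -/
def Blocks (E : α → α → Prop) (Z : Set α) (π : List α) : Prop :=
  (∃ v ∈ π, ¬ IsCollider E π v ∧ v ∈ Z) ∨
    (∃ v ∈ π, IsCollider E π v ∧ ∀ d, IsDesc E v d → d ∉ Z)

/-- d-separation of `A` and `B` by `C`. -/
def DSep (E : α → α → Prop) (A B C : Set α) : Prop :=
  ∀ a ∈ A, ∀ b ∈ B, ∀ π, IsPath E a b π → Blocks E C π

/-- The multivariate backdoor criterion for `Z` relative to the interventions `X` and the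
effects `Y`. -/
structure Backdoor (E : α → α → Prop) (X Y Z : Set α) : Prop where
  disjoint_XY : Disjoint X Y
  disjoint_ZX : Disjoint Z X
  disjoint_ZY : Disjoint Z Y
  not_desc : ∀ z ∈ Z, ∀ x ∈ X, ¬ IsDesc E x z
  blocks : ∀ x ∈ X, ∀ y ∈ Y, ∀ π,
    IsBackdoorPath (removeOut E (X \ {x})) x y π → Blocks (removeOut E (X \ {x})) Z π

end Graphs

/-! ### Full-time and summary causal graphs -/

/-- A vertex `(i, t)` is the instance at time `t` of the time series `i`. -/
abbrev Vertex (ι : Type*) := ι × ℤ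

/-- An acyclic full-time causal graph over the time series `ι`. Arrows do not go back in time;
lags may be arbitrarily large and arrows need not be repeated at all times. -/
structure FTCG (ι : Type*) where
  Adj : Vertex ι → Vertex ι → Prop
  time_le : ∀ {u v}, Adj u v → u.2 ≤ v.2
  acyclic : ∀ v, ¬ Relation.TransGen Adj v v

namespace FTCG

variable {ι : Type*} (G : FTCG ι)

/-- The parents of a vertex. -/
def parents (v : Vertex ι) : Set (Vertex ι) := {u | G.Adj u v}

/-- The ancestors of a vertex, itself included. -/
def ancestors (v : Vertex ι) : Set (Vertex ι) := {u | IsDesc G.Adj u v}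

/-- The edge relation of the summary causal graph reduced from `G`. -/
def summary (a b : ι) : Prop := ∃ t γ : ℤ, 0 ≤ γ ∧ G.Adj (a, t - γ) (b, t)

/-- `p` precedes `v` for the recursion that computes an intervened solution from the first time of
an intervention on. -/
def Prec (X : Set (Vertex ι)) (p v : Vertex ι) : Prop :=
  G.Adj p v ∧ ∃ a ∈ X, a.2 ≤ v.2

theorem wellFounded_prec [Finite ι] {X : Set (Vertex ι)} (hX : X.Finite) :
    WellFounded (G.Prec X) := by
  rw [wellFounded_iff_isEmpty_descending_chain]
  refine ⟨fun ⟨f, hf⟩ => ?_⟩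
  obtain ⟨m, hm⟩ : ∃ m : ℤ, ∀ a ∈ X, m ≤ a.2 := by
    obtain ⟨m, hm⟩ := (hX.image Prod.snd).bddBelow
    exact ⟨m, fun a ha => hm ⟨a, ha, rfl⟩⟩
  have hlow : ∀ n, m ≤ (f n).2 := fun n => by
    obtain ⟨a, ha, hle⟩ := (hf n).2
    exact (hm a ha).trans hle
  have hanti : Antitone fun n => (f n).2 := antitone_nat_of_succ_le fun n => G.time_le (hf n).1
  have hfin : (Set.univ ×ˢ Set.Icc m (f 0).2 : Set (Vertex ι)).Finite :=
    Set.finite_univ.prod (Set.finite_Icc _ _)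
  have hnot : ¬ Function.Injective f := fun hinj =>
    Set.infinite_range_of_injective hinj (hfin.subset (by
      rintro _ ⟨n, rfl⟩
      exact ⟨trivial, hlow n, hanti (Nat.zero_le n)⟩))
  have htrans : ∀ a k, Relation.TransGen G.Adj (f (a + k + 1)) (f a) := by
    intro a k
    induction k with
    | zero => exact .single (hf a).1
    | succ k ih => exact .head (hf (a + k + 1)).1 ih
  have key : ∀ a b, a < b → f a ≠ f b := by
    intro a b hab h
    obtain ⟨k, rfl⟩ := Nat.exists_eq_add_of_lt hab
    have := htrans a k
    rw [← h] at this
    exact G.acyclic _ this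
  exact hnot fun a b h => by
    rcases lt_trichotomy a b with hab | hab | hab
    · exact absurd h (key a b hab)
    · exact hab
    · exact absurd h.symm (key b a hab)

end FTCG

/-- The candidate full-time causal graphs of a summary causal graph with edge relation `Gs`. -/
def candidates {ι : Type*} (Gs : ι → ι → Prop) : Set (FTCG ι) := {G | G.summary = Gs}

/-! ### Dynamic structural causal models -/

/-- A dynamic structural causal model with full-time causal graph `G`, in which the time series `i`
takes its values in the discrete space `S i`. Causal sufficiency: the exogenous variables
of the vertices are independent (their joint law is the product measure `exoLaw` below).
Each vertex is a function of its parents and of its exogenous variable; as time has no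
beginning, these equations alone do not determine the model, which therefore comes with its
solution: each vertex is a function of the exogenous variables of its ancestors. -/
structure DSCM {ι : Type*} (G : FTCG ι) (S : ι → Type*) [∀ i, MeasurableSpace (S i)] where
  Exo : Vertex ι → Type*
  [measExo : ∀ v, MeasurableSpace (Exo v)]
  exo : ∀ v, Measure (Exo v)
  [probExo : ∀ v, IsProbabilityMeasure (exo v)]
  /-- the structural equations -/
  f : ∀ v : Vertex ι, (∀ p : G.parents v, S p.1.1) → Exo v → S v.1
  measurable_f : ∀ v, Measurable (Function.uncurry (f v))
  /-- the solution -/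
  sol : ∀ v : Vertex ι, (∀ a : G.ancestors v, Exo a.1) → S v.1
  measurable_sol : ∀ v, Measurable (sol v)
  sol_eq : ∀ v, ∀ᵐ u ∂(Measure.infinitePi exo),
    sol v (fun a => u a.1) = f v (fun p => sol p.1 (fun a => u a.1)) (u v)

namespace DSCM

variable {ι : Type*} {G : FTCG ι} {S : ι → Type*} [∀ i, MeasurableSpace (S i)] (M : DSCM G S)

instance (v : Vertex ι) : MeasurableSpace (M.Exo v) := M.measExo v

instance (v : Vertex ι) : IsProbabilityMeasure (M.exo v) := M.probExo v

/-- The joint law of the independent exogenous variables. -/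
noncomputable def exoLaw : Measure (∀ v, M.Exo v) := Measure.infinitePi M.exo

/-- The observed value of each vertex. -/
def obs (u : ∀ v, M.Exo v) (v : Vertex ι) : S v.1 := M.sol v (fun a => u a.1)

theorem measurable_obs : Measurable M.obs :=
  measurable_pi_lambda _ fun v => (M.measurable_sol v).comp
    (measurable_pi_lambda _ fun a => measurable_pi_apply a.1)

/-- The true (observational) probability distribution, on the trajectories of all vertices. -/
noncomputable def P : Measure (∀ v : Vertex ι, S v.1) := M.exoLaw.map M.obs

instance : IsProbabilityMeasure M.exoLaw := by unfold exoLaw; infer_instance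

instance : IsProbabilityMeasure M.P :=
  Measure.isProbabilityMeasure_map M.measurable_obs.aemeasurable

open Classical in
/-- The value of each vertex under the intervention `do(X = x)`: the vertices of `X` are set to `x`,
all other structural equations and the exogenous variables are kept, and what precedes in time all
the interventions is unchanged. -/
noncomputable def doSol [Finite ι] {X : Set (Vertex ι)} (hX : X.Finite) (x : ∀ v : X, S v.1.1)
    (u : ∀ v, M.Exo v) (v : Vertex ι) : S v.1 :=
  (G.wellFounded_prec hX).fix (C := fun v => S v.1)
    (fun v rec =>
      if h : v ∈ X then x ⟨v, h⟩
      else if h' : ∃ a ∈ X, a.2 ≤ v.2 then M.f v (fun p => rec p.1 ⟨p.2, h'⟩) (u v)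
      else M.obs u v) v

section

variable [Finite ι] {X : Set (Vertex ι)} (hX : X.Finite) (x : ∀ v : X, S v.1.1)
  (u : ∀ v, M.Exo v)

theorem doSol_of_mem {v : Vertex ι} (h : v ∈ X) : M.doSol hX x u v = x ⟨v, h⟩ := by
  rw [doSol, WellFounded.fix_eq, dif_pos h]

theorem doSol_of_before {v : Vertex ι} (h : ∀ a ∈ X, v.2 < a.2) :
    M.doSol hX x u v = M.obs u v := by
  rw [doSol, WellFounded.fix_eq, dif_neg (fun hv => lt_irrefl _ (h v hv)),
    dif_neg (by push Not; exact h)]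

theorem doSol_of_notMem {v : Vertex ι} (h : v ∉ X) (h' : ∃ a ∈ X, a.2 ≤ v.2) :
    M.doSol hX x u v = M.f v (fun p => M.doSol hX x u p.1) (u v) := by
  rw [doSol, WellFounded.fix_eq, dif_neg h, dif_pos h']
  rfl

theorem measurable_doSol : Measurable (M.doSol hX x) := by
  refine measurable_pi_lambda _ fun v => ?_
  induction v using (G.wellFounded_prec hX).induction with
  | _ v ih =>
    by_cases h : v ∈ X
    · simp only [M.doSol_of_mem hX x _ h]
      exact measurable_const
    by_cases h' : ∃ a ∈ X, a.2 ≤ v.2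
    · simp only [M.doSol_of_notMem hX x _ h h']
      exact (M.measurable_f v).comp ((measurable_pi_lambda _ fun p => ih p.1 ⟨p.2, h'⟩).prodMk
        (measurable_pi_apply v))
    · push Not at h'
      simp only [M.doSol_of_before hX x _ h']
      exact (measurable_pi_apply v).comp M.measurable_obs

end

/-- The interventional distribution `P(· | do(X = x))`. -/
noncomputable def doP [Finite ι] {X : Set (Vertex ι)} (hX : X.Finite) (x : ∀ v : X, S v.1.1) :
    Measure (∀ v : Vertex ι, S v.1) :=
  M.exoLaw.map (M.doSol hX x)

end DSCM

/-! ### Events, conditioning and the Markov property -/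

section Prob

variable {ι : Type*} {S : ι → Type*}

/-- The restriction of a trajectory to the vertices of `A`. -/
def proj (A : Set (Vertex ι)) (w : ∀ v : Vertex ι, S v.1) : ∀ v : A, S v.1.1 := fun v => w v.1

/-- The event that the vertices of `A` take the values `a`. -/
def event {A : Set (Vertex ι)} (a : ∀ v : A, S v.1.1) : Set (∀ v : Vertex ι, S v.1) :=
  {w | proj A w = a}

variable [∀ i, MeasurableSpace (S i)]

theorem measurable_proj (A : Set (Vertex ι)) : Measurable (proj A : (∀ v : Vertex ι, S v.1) → _) :=
  measurable_pi_lambda _ fun v => measurable_pi_apply v.1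

/-- `P` is Markov relative to the graph `E`: d-separation of pairwise disjoint
sets of vertices implies conditional independence. -/
def IsMarkov [Finite ι] [∀ i, StandardBorelSpace (S i)] (E : Vertex ι → Vertex ι → Prop)
    (P : Measure (∀ v : Vertex ι, S v.1)) [IsFiniteMeasure P] : Prop :=
  ∀ A B C : Set (Vertex ι), Disjoint A B → Disjoint A C → Disjoint B C → DSep E A B C →
    CondIndepFun (MeasurableSpace.comap (proj C) inferInstance) (measurable_proj C).comap_le
      (proj A) (proj B) P

end Prob

end CausalTS

/-! The argument is counterfactual. Under `do(X = x)`, let the natural value of a vertex (`natSol`)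
be what its own structural equation yields, even if the vertex lies in `X` and is overridden. Three
facts hold almost surely. Off `X` the natural values are the interventional ones. The natural values
of `X` equal `x` exactly when `X = x` is observed, and then every natural value is the observed one
(`natSol_eq_natSol`, `P_event_inter`). The vertices of `Z`, not being descendants of `X`, keep their
observed values. So the adjustment formula follows once the natural values of `X` and of `Y` are
conditionally independent given `Z`: the conditional probability of `Y = y` given `z` may then be
computed on the event `X = x`, where it is `P(y | x, z)`, and averaged over the law of `Z`.

Graphically, the criterion says that no vertex of `Y` is d-connected to a vertex of `X` once all
arrows leaving `X` are removed (`Backdoor.not_dConn`). The rest turns this into independence of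
noise.

For finite `Z`, one intervenes on `Z` as well, with values `z`. The natural value of `v` then
depends only on the noise in `reach G.Adj (X ∪ Z) v`. The set `Z` splits into the vertices that
share noise with the `X` side (`linked`) and the others; `X` with the linked ones and `Y` with the
others use disjoint noise, and the probabilities factor (`natSol_condIndep_of_finite`).

For infinite `Z` this recursion is not available, and the Markov property replaces it. The natural
values of `V = X` or `V = Y` are computed from `Z`, from the observations in `past G.Adj X Z V` and
from the noise in `core G.Adj X Z V`. The two pasts are d-separated by `Z` (`Backdoor.dSep_past`),
and the two cores carry disjoint noise independent of the rest (`exists_condProb_natSol`). -/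

namespace CausalTS

/-! ### Active paths and the extension of d-connection -/

section Trails

variable {α : Type*} {E : α → α → Prop} {Z : Set α}

/-- `v` has a descendant in `Z`. -/
def HasDescIn (E : α → α → Prop) (Z : Set α) (v : α) : Prop := ∃ d ∈ Z, IsDesc E v d

theorem HasDescIn.of_adj {a b : α} (h : E a b) (hb : HasDescIn E Z b) : HasDescIn E Z a := by
  obtain ⟨d, hd, hbd⟩ := hb
  exact ⟨d, hd, hbd.head h⟩

theorem HasDescIn.of_mem {a : α} (h : a ∈ Z) : HasDescIn E Z a := ⟨a, h, .refl⟩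

/-- `p 0, …, p n` is a path from `x` to `w` which is not blocked by `Z` at an inner vertex. -/
structure IsActive (E : α → α → Prop) (Z : Set α) (x w : α) (n : ℕ) (p : ℕ → α) : Prop where
  zero : p 0 = x
  last : p n = w
  inj : ∀ i j, i ≤ n → j ≤ n → p i = p j → i = j
  adj : ∀ k < n, E (p k) (p (k + 1)) ∨ E (p (k + 1)) (p k)
  collider : ∀ k, k + 1 < n → E (p k) (p (k + 1)) → E (p (k + 2)) (p (k + 1)) →
    HasDescIn E Z (p (k + 1))
  noncollider : ∀ k, k + 1 < n → ¬ (E (p k) (p (k + 1)) ∧ E (p (k + 2)) (p (k + 1))) →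
    p (k + 1) ∉ Z

theorem isActive_refl (x : α) : IsActive E Z x x 0 (fun _ => x) where
  zero := rfl
  last := rfl
  inj i j hi hj _ := by omega
  adj k hk := by omega
  collider k hk := by omega
  noncollider k hk := by omega

/-- An initial piece of an active path. -/
theorem IsActive.take {x w : α} {n : ℕ} {p : ℕ → α} (h : IsActive E Z x w n p) {k : ℕ}
    (hk : k ≤ n) : IsActive E Z x (p k) k p where
  zero := h.zero
  last := rfl
  inj i j hi hj := h.inj i j (hi.trans hk) (hj.trans hk)
  adj j hj := h.adj j (hj.trans_le hk)
  collider j hj := h.collider j (hj.trans_le hk)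
  noncollider j hj := h.noncollider j (hj.trans_le hk)

/-- Extension of an active path by one vertex. -/
theorem IsActive.snoc {x w w' : α} {n : ℕ} {p : ℕ → α} (h : IsActive E Z x w n p)
    (hw' : ∀ k ≤ n, p k ≠ w') (hadj : E w w' ∨ E w' w)
    (hcol : ∀ k, n = k + 1 → E (p k) w → E w' w → HasDescIn E Z w)
    (hnon : ∀ k, n = k + 1 → ¬ (E (p k) w ∧ E w' w) → w ∉ Z) :
    IsActive E Z x w' (n + 1) (fun k => if k ≤ n then p k else w') where
  zero := by simpa using h.zero
  last := by simp
  inj i j hi hj hij := by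
    by_cases h1 : i ≤ n <;> by_cases h2 : j ≤ n <;> simp only [h1, h2, if_true, if_false] at hij
    · exact h.inj i j h1 h2 hij
    · exact absurd hij (hw' i h1)
    · exact absurd hij.symm (hw' j h2)
    · omega
  adj k hk := by
    rcases Nat.lt_succ_iff_lt_or_eq.1 hk with hk | rfl
    · rw [if_pos hk.le, if_pos (Nat.succ_le_of_lt hk)]
      exact h.adj k hk
    · rw [if_pos le_rfl, if_neg (by omega), h.last]
      exact hadj
  collider k hk := by
    rcases Nat.lt_succ_iff_lt_or_eq.1 hk with hk | rfl
    · rw [if_pos (by omega), if_pos (by omega), if_pos (by omega)]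
      exact h.collider k hk
    · rw [if_pos (by omega), if_pos (by omega), if_neg (by omega), h.last]
      exact hcol k rfl
  noncollider k hk := by
    rcases Nat.lt_succ_iff_lt_or_eq.1 hk with hk | rfl
    · rw [if_pos (by omega), if_pos (by omega), if_pos (by omega)]
      exact h.noncollider k hk
    · rw [if_pos (by omega), if_pos (by omega), if_neg (by omega), h.last]
      exact hnon k rfl

/-- `w` is d-connected to `x`. -/
def DConn (E : α → α → Prop) (Z : Set α) (x w : α) : Prop :=
  w ∉ Z ∧ ∃ n p, IsActive E Z x w n p

/-- `w` is d-connected to `x` by a path which stays active when it goes on to a parent of `w`. -/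
def UpConn (E : α → α → Prop) (Z : Set α) (x w : α) : Prop :=
  w ∉ Z ∧ ∃ n p, IsActive E Z x w n p ∧
    (n = 0 ∨ HasDescIn E Z w ∨ ∃ m, n = m + 1 ∧ E w (p m))

theorem UpConn.dConn {x w : α} (h : UpConn E Z x w) : DConn E Z x w := by
  obtain ⟨hw, n, p, hp, -⟩ := h
  exact ⟨hw, n, p, hp⟩

theorem upConn_self {x : α} (hx : x ∉ Z) : UpConn E Z x x :=
  ⟨hx, 0, _, isActive_refl x, .inl rfl⟩

theorem DConn.upConn {x w : α} (h : DConn E Z x w) (hw : HasDescIn E Z w) : UpConn E Z x w := by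
  obtain ⟨hwZ, n, p, hp⟩ := h
  exact ⟨hwZ, n, p, hp, .inr (.inl hw)⟩

theorem DConn.down {x w w' : α} (h : DConn E Z x w) (hE : E w w')
    (hasymm : ∀ a b, E a b → ¬ E b a) (hw' : w' ∉ Z) : DConn E Z x w' := by
  obtain ⟨hw, n, p, hp⟩ := h
  by_cases hmem : ∃ k ≤ n, p k = w'
  · obtain ⟨k, hk, rfl⟩ := hmem
    exact ⟨hw', k, p, hp.take hk⟩
  · push Not at hmem
    exact ⟨hw', _, _, hp.snoc hmem (.inl hE) (fun k _ _ h2 => absurd h2 (hasymm _ _ hE))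
      (fun k _ _ => hw)⟩

/-- If `w'` has a descendant in `Z`, any active path to `w'` will do. Otherwise the delicate case is
that `w'` already lies on the path and is entered there by an arrow. With no descendant in `Z`,
neither it nor any later vertex can be an active collider, so the path runs along arrows from `w'`
to `w` and enters `w` by an arrow, contrary to up-connection of `w`. -/
theorem UpConn.up {x w w' : α} (h : UpConn E Z x w) (hE : E w' w)
    (hasymm : ∀ a b, E a b → ¬ E b a) (hw' : w' ∉ Z) : UpConn E Z x w' := by
  by_cases hH : HasDescIn E Z w'
  · obtain ⟨hw, n, p, hp, hup⟩ := h
    refine DConn.upConn ⟨hw', ?_⟩ hH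
    by_cases hmem : ∃ k ≤ n, p k = w'
    · obtain ⟨k, hk, rfl⟩ := hmem
      exact ⟨k, p, hp.take hk⟩
    · push Not at hmem
      refine ⟨_, _, hp.snoc hmem (.inr hE) ?_ fun k _ _ => hw⟩
      rintro k rfl h1 -
      rcases hup with h0 | h0 | ⟨m, h0, h2⟩
      · omega
      · exact h0
      · obtain rfl : k = m := by omega
        exact absurd h1 (hasymm _ _ h2)
  obtain ⟨hw, n, p, hp, hup⟩ := h
  have hHw : ¬ HasDescIn E Z w := fun h => hH (h.of_adj hE)
  by_cases hmem : ∃ k ≤ n, p k = w'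
  · obtain ⟨k, hk, rfl⟩ := hmem
    refine ⟨hw', k, p, hp.take hk, ?_⟩
    rcases k with _ | m
    · exact .inl rfl
    refine .inr (.inr ⟨m, rfl, ?_⟩)
    refine (hp.adj m (by omega)).resolve_left fun hin => ?_
    have key : ∀ j, m + 1 + j < n →
        ¬ HasDescIn E Z (p (m + 1 + j)) ∧ E (p (m + 1 + j)) (p (m + 1 + j + 1)) := by
      intro j
      induction j with
      | zero =>
        intro hj
        refine ⟨hH, (hp.adj _ hj).resolve_right fun h2 => hH (hp.collider m hj hin h2)⟩
      | succ j ih =>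
        intro hj
        obtain ⟨h1, h2⟩ := ih (by omega)
        have h3 : ¬ HasDescIn E Z (p (m + 1 + (j + 1))) := fun h => h1 (h.of_adj h2)
        exact ⟨h3, (hp.adj _ hj).resolve_right fun h4 => h3 (hp.collider (m + 1 + j) hj h2 h4)⟩
    have hne : m + 1 ≠ n := by
      rintro rfl
      rw [hp.last] at hE
      exact hasymm _ _ hE hE
    obtain ⟨j, rfl⟩ : ∃ j, n = m + 1 + j + 1 := ⟨n - (m + 2), by omega⟩
    have h1 := (key j (by omega)).2
    rw [hp.last] at h1
    rcases hup with h0 | h0 | ⟨m', h0, h2⟩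
    · omega
    · exact hHw h0
    · obtain rfl : m' = m + 1 + j := by omega
      exact hasymm _ _ h1 h2
  · push Not at hmem
    refine ⟨hw', _, _, hp.snoc hmem (.inr hE) ?_ fun k _ _ => hw, .inr (.inr ⟨n, rfl, ?_⟩)⟩
    · rintro k rfl h1 -
      rcases hup with h0 | h0 | ⟨m, h0, h2⟩
      · omega
      · exact h0
      · obtain rfl : k = m := by omega
        exact absurd h1 (hasymm _ _ h2)
    · rw [if_pos le_rfl, hp.last]
      exact hE

/-- Passing through a collider in `Z`. -/
theorem DConn.collider {x w z w' : α} (h : DConn E Z x w) (hE : E w z) (hE' : E w' z)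
    (hasymm : ∀ a b, E a b → ¬ E b a) (hx : x ∉ Z) (hz : z ∈ Z) (hw' : w' ∉ Z) :
    UpConn E Z x w' := by
  obtain ⟨hw, n, p, hp⟩ := h
  have hzH : HasDescIn E Z z := .of_mem hz
  refine DConn.upConn ⟨hw', ?_⟩ (hzH.of_adj hE')
  by_cases hmem : ∃ k ≤ n, p k = w'
  · obtain ⟨k, hk, rfl⟩ := hmem
    exact ⟨k, p, hp.take hk⟩
  push Not at hmem
  -- If `z` is already on the path, it is an inner vertex because the ends are outside `Z`, hence a
  -- collider because `z ∈ Z`; the path is cut there and continued to `w'`.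
  by_cases hmz : ∃ k ≤ n, p k = z
  · obtain ⟨k, hk, rfl⟩ := hmz
    have hkn : k ≠ n := fun h => hw (by rw [← hp.last, ← h]; exact hz)
    rcases k with _ | m
    · exact absurd hz (by rw [hp.zero]; exact hx)
    have hc := not_imp_comm.1 (hp.noncollider m (by omega)) (not_not.2 hz)
    refine ⟨_, _, (hp.take hk).snoc (fun j hj => hmem j (hj.trans hk)) (.inr hE')
      (fun _ _ _ _ => hzH) ?_⟩
    intro j hj h
    obtain rfl : m = j := by omega
    exact absurd ⟨hc.1, hE'⟩ h
  · push Not at hmz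
    have h1 := hp.snoc hmz (.inl hE) (fun k _ _ h2 => absurd h2 (hasymm _ _ hE)) (fun k _ _ => hw)
    refine ⟨_, _, h1.snoc ?_ (.inr hE') (fun _ _ _ _ => hzH) ?_⟩
    · intro k hk
      by_cases hkn : k ≤ n
      · simpa only [hkn, if_true] using hmem k hkn
      · simp only [hkn, if_false]
        rintro rfl
        exact hw' hz
    · intro k hk h
      obtain rfl : n = k := by omega
      refine absurd ⟨?_, hE'⟩ h
      rw [if_pos le_rfl, hp.last]
      exact hE

/-- Vertices from which `w` can be reached by arrows that do not leave `Z` are up-connected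
if `w` is. -/
theorem UpConn.up_trans {x a w : α} (h : UpConn E Z x w) (ha : IsDesc (removeOut E Z) a w)
    (hasymm : ∀ a b, E a b → ¬ E b a) : UpConn E Z x a := by
  induction ha using Relation.ReflTransGen.head_induction_on with
  | refl => exact h
  | head hab _ ih => exact ih.up hab.1 hasymm hab.2

theorem DConn.down_trans {x a b : α} (h : DConn E Z x a) (hab : IsDesc (removeOut E Z) a b)
    (hasymm : ∀ a b, E a b → ¬ E b a) (hb : b ∉ Z) : DConn E Z x b := by
  induction hab with
  | refl => exact h
  | tail _ hmb ih => exact (ih hmb.2).down hmb.1 hasymm hb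

/-- Descend from `a` to `z`, cross `z` as a collider, and climb to `a'`. -/
theorem UpConn.through {x z a a' : α} (h : UpConn E Z x a) (ha : IsDesc (removeOut E Z) a z)
    (hasymm : ∀ a b, E a b → ¬ E b a) (hx : x ∉ Z) (hz : z ∈ Z) (ha' : IsDesc (removeOut E Z) a' z)
    (ha'Z : a' ∉ Z) : UpConn E Z x a' := by
  rcases Relation.ReflTransGen.cases_tail ha with rfl | ⟨m, ham, hmz⟩
  · exact absurd hz h.1
  rcases Relation.ReflTransGen.cases_tail ha' with rfl | ⟨m', ham', hmz'⟩
  · exact absurd hz ha'Z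
  exact ((h.dConn.down_trans ham hasymm hmz.2).collider hmz.1 hmz'.1 hasymm hx hz hmz'.2).up_trans
    ham' hasymm

end Trails

/-! ### Consequences of the backdoor criterion for d-separation -/

section Separation

variable {α : Type*} {E : α → α → Prop} {X Y Z : Set α}

theorem removeOut_removeOut : removeOut (removeOut E X) Z = removeOut E (X ∪ Z) := by
  ext a b
  simp only [removeOut, Set.mem_union]
  tauto

theorem removeOut_asymm (h : ∀ a b, E a b → ¬ E b a) (a b : α) (hab : removeOut E X a b) :
    ¬ removeOut E X b a := fun hba => h a b hab.1 hba.1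

/-- A directed path to a non-descendant of `X` never meets `X`. -/
theorem IsDesc.avoiding {v z : α} (h : IsDesc E v z) (hz : ∀ x ∈ X, ¬ IsDesc E x z) :
    IsDesc (removeOut E X) v z := by
  induction h using Relation.ReflTransGen.head_induction_on with
  | refl => exact .refl
  | head hab hbz ih => exact ih.head ⟨hab, fun ha => hz _ ha (hbz.head hab)⟩

theorem IsActive.isPath {x w : α} {n : ℕ} {p : ℕ → α} (h : IsActive E Z x w n p) :
    IsPath E x w ((List.range (n + 1)).map p) where
  nodup := by
    refine List.Nodup.map_on ?_ List.nodup_range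
    intro i hi j hj
    simp only [List.mem_range] at hi hj
    exact h.inj i j (by omega) (by omega)
  chain := by
    rw [List.isChain_iff_getElem]
    intro i hi
    simp only [List.length_map, List.length_range] at hi
    simp only [List.getElem_map, List.getElem_range]
    exact h.adj i (by omega)
  head := by simp [List.head?_range, h.zero]
  last := by simp [List.getLast?_range, h.last]

theorem infix_map_range_iff {n : ℕ} {p : ℕ → α} {u v w : α} :
    [u, v, w] <:+: (List.range (n + 1)).map p ↔
      ∃ k, k + 1 < n ∧ u = p k ∧ v = p (k + 1) ∧ w = p (k + 2) := by
  rw [List.infix_iff_getElem?]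
  constructor
  · rintro ⟨k, hk, h⟩
    simp only [List.length_map, List.length_range, List.length_cons, List.length_nil] at hk
    have h0 := h 0 (by simp)
    have h1 := h 1 (by simp)
    have h2 := h 2 (by simp)
    simp only [List.getElem?_map, List.getElem?_range (show 0 + k < n + 1 by omega),
      List.getElem?_range (show 1 + k < n + 1 by omega),
      List.getElem?_range (show 2 + k < n + 1 by omega), Option.map_some, Option.some.injEq,
      List.getElem_cons_zero, List.getElem_cons_succ] at h0 h1 h2
    refine ⟨k, by omega, ?_, ?_, ?_⟩
    · rw [← h0, Nat.zero_add]
    · rw [← h1, Nat.add_comm]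
    · rw [← h2, Nat.add_comm]
  · rintro ⟨k, hk, rfl, rfl, rfl⟩
    refine ⟨k, by simp; omega, ?_⟩
    intro i hi
    simp only [List.length_cons, List.length_nil] at hi
    rw [List.getElem?_map, List.getElem?_range (by omega)]
    interval_cases i <;> simp [Nat.add_comm]

/-- The backdoor criterion forbids d-connection in the graph without the arrows that leave `X`. -/
theorem Backdoor.not_dConn (h : Backdoor E X Y Z) (hasymm : ∀ a b, E a b → ¬ E b a) {x y : α}
    (hx : x ∈ X) (hy : y ∈ Y) : ¬ DConn (removeOut E X) Z x y := by
  rintro ⟨hyZ, n, p, hp⟩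
  have hxZ : x ∉ Z := fun hxZ => h.disjoint_ZX.le_bot ⟨hxZ, hx⟩
  have hmono : ∀ a b, removeOut E X a b → removeOut E (X \ {x}) a b :=
    fun a b hab => ⟨hab.1, fun ha => hab.2 ha.1⟩
  have hn : 0 < n := by
    rcases Nat.eq_zero_or_pos n with rfl | h0
    · have : x = y := by rw [← hp.zero, ← hp.last]
      exact absurd ⟨hx, this ▸ hy⟩ (fun hh : x ∈ X ∩ Y => h.disjoint_XY.le_bot hh)
    · exact h0
  have hpath := hp.isPath
  -- No arrow of the smaller graph leaves `x ∈ X`, so the first arrow of the path must point to `x`.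
  have hback : IsBackdoorPath (removeOut E (X \ {x})) x y ((List.range (n + 1)).map p) := by
    refine ⟨⟨hpath.nodup, hpath.chain.imp fun a b => Or.imp (hmono a b) (hmono b a), hpath.head,
      hpath.last⟩, p 1, ?_, ?_⟩
    · obtain ⟨m, rfl⟩ : ∃ m, n = m + 1 := ⟨n - 1, by omega⟩
      rw [List.range_succ_eq_map, List.range_succ_eq_map]
      simp [hp.zero]
    · have := (hp.adj 0 hn).resolve_left (fun h0 => h0.2 (by rw [hp.zero]; exact hx))
      rw [hp.zero] at this
      exact hmono _ _ this
  rcases h.blocks x hx y hy _ hback with ⟨v, hv, hnc, hvZ⟩ | ⟨v, hv, hc, hd⟩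
  · obtain ⟨k, hk, rfl⟩ := List.mem_map.1 hv
    have hk := List.mem_range.1 hk
    rcases k with _ | k
    · rw [hp.zero] at hvZ
      exact hxZ hvZ
    have hkn : k + 1 < n := by
      refine lt_of_le_of_ne (by omega) fun h' => hyZ ?_
      rw [← hp.last, ← h']
      exact hvZ
    refine hp.noncollider k hkn (fun hc => hnc ?_) hvZ
    exact ⟨p k, p (k + 2), infix_map_range_iff.2 ⟨k, hkn, rfl, rfl, rfl⟩, hmono _ _ hc.1,
      hmono _ _ hc.2⟩
  · obtain ⟨u, w, hin, huv, hwv⟩ := hc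
    obtain ⟨k, hkn, rfl, rfl, rfl⟩ := infix_map_range_iff.1 hin
    -- By asymmetry the two graphs orient the edges of the path alike, so a collider in the larger
    -- graph is one in the smaller.
    have h1 := (hp.adj k (by omega)).resolve_right fun h1 => hasymm _ _ huv.1 h1.1
    have h2 := (hp.adj (k + 1) hkn).resolve_left fun h1 => hasymm _ _ hwv.1 h1.1
    obtain ⟨d, hdZ, hvd⟩ := hp.collider k hkn h1 h2
    exact hd d (Relation.ReflTransGen.mono hmono _ _ hvd) hdZ

/-- A path that is not blocked is active. -/
theorem IsPath.exists_isActive {a b : α} {π : List α} (h : IsPath E a b π)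
    (hb : ¬ Blocks E Z π) : ∃ n p, IsActive E Z a b n p := by
  obtain ⟨n, hn⟩ : ∃ n, π.length = n + 1 := by
    cases π with
    | nil => simpa using h.head
    | cons c t => exact ⟨t.length, rfl⟩
  have hget : ∀ k (hk : k < n + 1), π.getD k a = π[k] := fun k hk => by
    rw [List.getD_eq_getElem]
  have hπ : π = (List.range (n + 1)).map fun k => π.getD k a := by
    refine List.ext_getElem (by simp [hn]) fun i h1 h2 => ?_
    rw [List.getElem_map, List.getElem_range, hget i (by omega)]
  simp only [Blocks, not_or, not_exists, not_and] at hb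
  refine ⟨n, fun k => π.getD k a, ?_, ?_, ?_, ?_, ?_, ?_⟩
  · have := h.head
    rw [List.head?_eq_getElem?] at this
    simp [List.getD, this]
  · have := h.last
    rw [List.getLast?_eq_getElem?, hn] at this
    simp only [Nat.add_sub_cancel] at this
    simp [List.getD, this]
  · intro i j hi hj hij
    rw [hget i (by omega), hget j (by omega)] at hij
    exact h.nodup.getElem_inj_iff.1 hij
  · intro k hk
    have := List.isChain_iff_getElem.1 h.chain k (by omega)
    rwa [← hget k (by omega), ← hget (k + 1) (by omega)] at this
  · intro k hk h1 h2
    have hc : IsCollider E π (π.getD (k + 1) a) := by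
      refine ⟨_, _, ?_, h1, h2⟩
      nth_rw 4 [hπ]
      exact infix_map_range_iff.2 ⟨k, hk, rfl, rfl, rfl⟩
    have hmem : π.getD (k + 1) a ∈ π := by
      rw [hget _ (by omega)]
      exact List.getElem_mem _
    have := hb.2 _ hmem hc
    push Not at this
    obtain ⟨d, hd, hdZ⟩ := this
    exact ⟨d, hdZ, hd⟩
  · intro k hk hnc hZ
    have hmem : π.getD (k + 1) a ∈ π := by
      rw [hget _ (by omega)]
      exact List.getElem_mem _
    refine hb.1 _ hmem ?_ hZ
    rintro ⟨u, w, hin, hu, hw⟩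
    rw [hπ] at hin
    obtain ⟨j, hj, rfl, h1, rfl⟩ := infix_map_range_iff.1 hin
    have hjk : k = j := by
      rw [← hπ, hget _ (by omega), hget _ (by omega)] at h1
      have := h.nodup.getElem_inj_iff.1 h1
      omega
    subst hjk
    exact hnc ⟨hu, hw⟩

/-- Every vertex of an active path is an ancestor of an end point or of the conditioning set. -/
theorem IsActive.hasDescIn {a b : α} {n : ℕ} {p : ℕ → α} (h : IsActive E Z a b n p) {k : ℕ}
    (hk : k ≤ n) : HasDescIn E (Z ∪ {a, b}) (p k) := by
  have hZ : ∀ v, HasDescIn E Z v → HasDescIn E (Z ∪ {a, b}) v :=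
    fun v ⟨d, hd, hvd⟩ => ⟨d, .inl hd, hvd⟩
  -- Arrows pointing right are followed until a collider, which has a descendant in `Z`, or until
  -- `b`; `hL` does the same leftwards, towards `a`.
  have hR : ∀ j k, k + j = n → (k < n → E (p k) (p (k + 1))) →
      HasDescIn E (Z ∪ {a, b}) (p k) := by
    intro j
    induction j with
    | zero =>
      rintro k hk -
      obtain rfl : k = n := by omega
      exact .of_mem (.inr (.inr h.last))
    | succ j ih =>
      intro k hk h1
      have h1 := h1 (by omega)
      refine .of_adj h1 ?_
      by_cases hkn : k + 1 < n
      · rcases h.adj (k + 1) hkn with h2 | h2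
        · exact ih (k + 1) (by omega) fun _ => h2
        · exact hZ _ (h.collider k hkn h1 h2)
      · exact ih (k + 1) (by omega) fun h3 => absurd h3 hkn
  have hL : ∀ k ≤ n, (∀ m, k = m + 1 → E (p k) (p m)) → HasDescIn E (Z ∪ {a, b}) (p k) := by
    intro k
    induction k with
    | zero =>
      rintro - -
      exact .of_mem (.inr (.inl h.zero))
    | succ k ih =>
      intro hk h1
      have h1 := h1 k rfl
      refine .of_adj h1 ?_
      rcases k with _ | k
      · exact ih (by omega) fun m hm => by omega
      rcases h.adj k (by omega) with h2 | h2
      · exact hZ _ (h.collider k (by omega) h2 h1)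
      · exact ih (by omega) fun m hm => by
          obtain rfl : k = m := by omega
          exact h2
  rcases k with _ | k
  · exact hL 0 hk fun m hm => by omega
  by_cases hkn : k + 1 < n
  · rcases h.adj k (by omega) with h1 | h1
    · rcases h.adj (k + 1) hkn with h2 | h2
      · exact hR (n - (k + 1)) (k + 1) (by omega) fun _ => h2
      · exact hZ _ (h.collider k hkn h1 h2)
    · exact hL _ hk fun m hm => by
        obtain rfl : k = m := by omega
        exact h1
  · exact hR 0 (k + 1) (by omega) fun h => absurd h hkn

/-- d-connection is transmitted along active paths between non-descendants of `X`. -/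
theorem UpConn.dConn_of_isActive {x a b : α} {n : ℕ} {p : ℕ → α}
    (hp : IsActive E Z a b n p) (ha : UpConn (removeOut E X) Z x a)
    (hasymm : ∀ a b, E a b → ¬ E b a) (hx : x ∉ Z) (hbZ : b ∉ Z)
    (hZ : ∀ z ∈ Z, ∀ x ∈ X, ¬ IsDesc E x z) (haX : ∀ x ∈ X, ¬ IsDesc E x a)
    (hbX : ∀ x ∈ X, ¬ IsDesc E x b) : DConn (removeOut E X) Z x b := by
  have hasymm' := removeOut_asymm (X := X) hasymm
  -- Each vertex of the path has a descendant in `Z ∪ {a, b}`, where nothing descends from `X`; so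
  -- the whole path survives the removal of the arrows leaving `X`.
  have hpX : ∀ k ≤ n, p k ∉ X := by
    intro k hk hkX
    obtain ⟨d, hd, hkd⟩ := hp.hasDescIn hk
    rcases hd with hd | rfl | rfl
    · exact hZ d hd _ hkX hkd
    · exact haX _ hkX hkd
    · exact hbX _ hkX hkd
  have hout : ∀ k < n, E (p (k + 1)) (p k) → p (k + 1) ∉ Z := by
    intro k hk h1
    by_cases hkn : k + 1 < n
    · exact hp.noncollider k hkn fun h2 => hasymm _ _ h1 h2.1
    · obtain rfl : k + 1 = n := by omega
      rwa [hp.last]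
  -- Concatenating paths could repeat vertices, so d-connection is instead propagated vertex by
  -- vertex. Up-connection is retained at the start and at vertices left by an arrow to their
  -- predecessor; a vertex in `Z` is a collider, and only the d-connection of its predecessor is
  -- remembered.
  have key : ∀ k ≤ n, (p k ∉ Z → DConn (removeOut E X) Z x (p k) ∧
      ((k = 0 ∨ ∃ m, k = m + 1 ∧ E (p k) (p m)) → UpConn (removeOut E X) Z x (p k))) ∧
      (p k ∈ Z → ∃ m, k = m + 1 ∧ E (p m) (p k) ∧ DConn (removeOut E X) Z x (p m)) := by
    intro k
    induction k with
    | zero =>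
      intro _
      rw [hp.zero]
      exact ⟨fun _ => ⟨ha.dConn, fun _ => ha⟩, fun h => absurd h ha.1⟩
    | succ k ih =>
      intro hk
      obtain ⟨ih1, ih2⟩ := ih (by omega)
      by_cases hkZ : p k ∈ Z
      · obtain ⟨m, rfl, h1, h2⟩ := ih2 hkZ
        have h3 := (not_imp_comm.1 (hp.noncollider m (by omega)) (not_not.2 hkZ)).2
        have h4 := hout (m + 1) (by omega) h3
        have h5 := h2.collider ⟨h1, hpX _ (by omega)⟩ ⟨h3, hpX _ hk⟩ hasymm' hx hkZ h4
        exact ⟨fun _ => ⟨h5.dConn, fun _ => h5⟩, fun h => absurd h h4⟩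
      · obtain ⟨h1, h2⟩ := ih1 hkZ
        rcases hp.adj k (by omega) with h3 | h3
        · refine ⟨fun h4 => ⟨h1.down ⟨h3, hpX _ (by omega)⟩ hasymm' h4, ?_⟩,
            fun _ => ⟨k, rfl, h3, h1⟩⟩
          rintro (h5 | ⟨m, hm, h5⟩)
          · omega
          · obtain rfl : k = m := by omega
            exact absurd h5 (hasymm _ _ h3)
        · have h4 := hout k (by omega) h3
          have h5 : UpConn (removeOut E X) Z x (p k) := by
            rcases k with _ | m
            · exact h2 (.inl rfl)
            rcases hp.adj m (by omega) with h5 | h5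
            · obtain ⟨d, hd, h6⟩ := hp.collider m (by omega) h5 h3
              exact h1.upConn ⟨d, hd, h6.avoiding (hZ d hd)⟩
            · exact h2 (.inr ⟨m, rfl, h5⟩)
          have h6 := h5.up ⟨h3, hpX _ hk⟩ hasymm' h4
          exact ⟨fun _ => ⟨h6.dConn, fun _ => h6⟩, fun h => absurd h h4⟩
  have := (key n le_rfl).1
  rw [hp.last] at this
  exact (this hbZ).1

/-- The vertices from which `v` can be reached by arrows that do not leave `C`. -/
def reach (E : α → α → Prop) (C : Set α) (v : α) : Set α := {a | IsDesc (removeOut E C) a v}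

theorem eq_or_notMem_of_mem_reach {C : Set α} {a v : α} (h : a ∈ reach E C v) : a = v ∨ a ∉ C := by
  rcases Relation.ReflTransGen.cases_head h with rfl | ⟨b, hab, -⟩
  · exact .inl rfl
  · exact .inr hab.2

theorem reach_of_adj {C : Set α} {a b v : α} (h : b ∈ reach E C v) (hab : E a b) (ha : a ∉ C) :
    a ∈ reach E C v := Relation.ReflTransGen.head ⟨hab, ha⟩ h

theorem Backdoor.upConn_of_mem_reach (h : Backdoor E X Y Z) (hasymm : ∀ a b, E a b → ¬ E b a)
    {x a : α} (hx : x ∈ X) (ha : a ∈ reach E (X ∪ Z) x) : UpConn (removeOut E X) Z x a := by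
  rw [reach, ← removeOut_removeOut] at ha
  exact (upConn_self fun hxZ => h.disjoint_ZX.le_bot ⟨hxZ, hx⟩).up_trans ha
    (removeOut_asymm hasymm)

theorem Backdoor.not_dConn_of_mem_reach (h : Backdoor E X Y Z)
    (hasymm : ∀ a b, E a b → ¬ E b a) {x y a : α} (hx : x ∈ X) (hy : y ∈ Y)
    (ha : a ∈ reach E (X ∪ Z) y) : ¬ DConn (removeOut E X) Z x a := by
  rw [reach, ← removeOut_removeOut] at ha
  exact fun hd => h.not_dConn hasymm hx hy
    (hd.down_trans ha (removeOut_asymm hasymm) fun hyZ => h.disjoint_ZY.le_bot ⟨hyZ, hy⟩)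

/-- The vertices of `Z` that share an unconditioned ancestor with a vertex d-connected to `X`. -/
def linked (E : α → α → Prop) (X Z : Set α) : Set α :=
  {z ∈ Z | ∃ a ∈ reach E (X ∪ Z) z, ∃ x ∈ X, UpConn (removeOut E X) Z x a}

/-- The vertices whose noise is shared with `X` in the presence of `Z`. -/
def side (E : α → α → Prop) (X Z : Set α) : Set α :=
  {a | ∃ x ∈ X, UpConn (removeOut E X) Z x a} ∪ linked E X Z

/-- From `v ∈ X` one climbs directly. For a linked `v`, one descends to `v` from its up-connected
ancestor and climbs back through the collider `v`. -/
theorem Backdoor.reach_subset_side (h : Backdoor E X Y Z) (hasymm : ∀ a b, E a b → ¬ E b a)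
    {v : α} (hv : v ∈ X ∪ linked E X Z) : reach E (X ∪ Z) v ⊆ side E X Z := by
  intro a ha
  rcases hv with hv | ⟨hvZ, b, hb, x, hx, hu⟩
  · exact .inl ⟨v, hv, h.upConn_of_mem_reach hasymm hv ha⟩
  · by_cases haZ : a ∈ Z
    · rcases eq_or_notMem_of_mem_reach ha with rfl | h1
      · exact .inr ⟨hvZ, b, hb, x, hx, hu⟩
      · exact absurd (.inr haZ) h1
    · rw [reach, ← removeOut_removeOut] at ha hb
      exact .inl ⟨x, hx, hu.through hb (removeOut_asymm hasymm)
        (fun hxZ => h.disjoint_ZX.le_bot ⟨hxZ, hx⟩) hvZ ha haZ⟩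

/-- An up-connected vertex reaching `Y` would violate the criterion, and one reaching a vertex of
`Z` would make that vertex linked. -/
theorem Backdoor.reach_subset_compl_side (h : Backdoor E X Y Z)
    (hasymm : ∀ a b, E a b → ¬ E b a) {v : α} (hv : v ∈ Y ∪ Z \ linked E X Z) :
    reach E (X ∪ Z) v ⊆ (side E X Z)ᶜ := by
  intro a ha has
  rcases has with ⟨x, hx, hu⟩ | hl
  · rcases hv with hv | hv
    · exact h.not_dConn_of_mem_reach hasymm hx hv ha hu.dConn
    · exact hv.2 ⟨hv.1, a, ha, x, hx, hu⟩
  · rcases eq_or_notMem_of_mem_reach ha with rfl | h1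
    · rcases hv with hv | hv
      · exact h.disjoint_ZY.le_bot ⟨hl.1, hv⟩
      · exact hv.2 hl
    · exact h1 (.inr hl.1)

/-- The non-descendants of `X` that influence some vertex of `V` without passing through
`X ∪ Z`. -/
def past (E : α → α → Prop) (X Z V : Set α) : Set α :=
  {a | (∀ x ∈ X, ¬ IsDesc E x a) ∧ ∃ v ∈ V, a ∈ reach E (X ∪ Z) v}

theorem past_disjoint {V : Set α} (h : Disjoint Z V) : Disjoint (past E X Z V) Z := by
  rw [Set.disjoint_left]
  rintro a ⟨-, v, hv, ha⟩ haZ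
  rcases eq_or_notMem_of_mem_reach ha with rfl | h1
  · exact h.le_bot ⟨haZ, hv⟩
  · exact h1 (.inr haZ)

/-- An unblocked path between the two pasts would extend to a d-connection of some `x` and `y`,
through a directed path from `a` to `x` at one end and from `b` to `y` at the other. -/
theorem Backdoor.dSep_past (h : Backdoor E X Y Z) (hasymm : ∀ a b, E a b → ¬ E b a) :
    DSep E (past E X Z X) (past E X Z Y) Z := by
  rintro a ⟨haX, x, hx, hax⟩ b ⟨hbX, y, hy, hby⟩ π hπ
  by_contra hb
  obtain ⟨n, p, hp⟩ := hπ.exists_isActive hb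
  have hbZ : b ∉ Z := Set.disjoint_left.1 (past_disjoint h.disjoint_ZY) ⟨hbX, y, hy, hby⟩
  exact h.not_dConn_of_mem_reach hasymm hx hy hby
    ((h.upConn_of_mem_reach hasymm hx hax).dConn_of_isActive hp hasymm
      (fun hxZ => h.disjoint_ZX.le_bot ⟨hxZ, hx⟩) hbZ h.not_desc haX hbX)

theorem Backdoor.disjoint_reach (h : Backdoor E X Y Z) (hasymm : ∀ a b, E a b → ¬ E b a)
    {x y : α} (hx : x ∈ X) (hy : y ∈ Y) :
    Disjoint (reach E (X ∪ Z) x) (reach E (X ∪ Z) y) :=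
  Set.disjoint_left.2 fun _ hax hay =>
    h.not_dConn_of_mem_reach hasymm hx hy hay (h.upConn_of_mem_reach hasymm hx hax).dConn

end Separation

theorem FTCG.asymm {ι : Type*} (G : FTCG ι) (a b : Vertex ι) (h : G.Adj a b) : ¬ G.Adj b a :=
  fun h' => G.acyclic a (.head h (.single h'))

theorem FTCG.time_le_of_isDesc {ι : Type*} (G : FTCG ι) {a b : Vertex ι} (h : IsDesc G.Adj a b) :
    a.2 ≤ b.2 := by
  induction h with
  | refl => exact le_rfl
  | tail _ h ih => exact ih.trans (G.time_le h)

/-! ### Natural values under an intervention and the noise they depend on -/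

section Override

variable {ι : Type*} {S : ι → Type*}

open Classical in
/-- The trajectory `w` with the values at the vertices of `C` replaced by `c`. -/
noncomputable def override {C : Set (Vertex ι)} (c : ∀ v : C, S v.1.1) (w : ∀ v : Vertex ι, S v.1)
    (v : Vertex ι) : S v.1 :=
  if h : v ∈ C then c ⟨v, h⟩ else w v

theorem override_of_mem {C : Set (Vertex ι)} (c : ∀ v : C, S v.1.1) (w : ∀ v : Vertex ι, S v.1)
    {v : Vertex ι} (h : v ∈ C) : override c w v = c ⟨v, h⟩ := dif_pos h

theorem override_of_notMem {C : Set (Vertex ι)} (c : ∀ v : C, S v.1.1) (w : ∀ v : Vertex ι, S v.1)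
    {v : Vertex ι} (h : v ∉ C) : override c w v = w v := dif_neg h

open Classical in
/-- The valuation of `X ∪ Z` given by valuations of `X` and of `Z`. -/
noncomputable def glue {X Z : Set (Vertex ι)} (x : ∀ v : X, S v.1.1) (z : ∀ v : Z, S v.1.1)
    (v : (X ∪ Z : Set (Vertex ι))) : S v.1.1 :=
  if h : v.1 ∈ X then x ⟨v.1, h⟩ else z ⟨v.1, v.2.resolve_left h⟩

end Override

namespace DSCM

variable {ι : Type*} {G : FTCG ι} {S : ι → Type*} [∀ i, MeasurableSpace (S i)] (M : DSCM G S)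

/-- The observed values satisfy all structural equations at `u`. -/
def Solves (u : ∀ v, M.Exo v) : Prop :=
  ∀ v, M.obs u v = M.f v (fun p => M.obs u p.1) (u v)

/-- There are countably many vertices, so one null set serves for all equations. -/
theorem ae_solves [Finite ι] : ∀ᵐ u ∂M.exoLaw, M.Solves u :=
  ae_all_iff.2 M.sol_eq

open Classical in
/-- The natural values under the intervention `do(C = c)`: the value each vertex, in `C` or not,
would take by its own structural equation. -/
noncomputable def natSol [Finite ι] {C : Set (Vertex ι)} (hC : C.Finite) (c : ∀ v : C, S v.1.1)
    (u : ∀ v, M.Exo v) (v : Vertex ι) : S v.1 :=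
  (G.wellFounded_prec hC).fix (C := fun v => S v.1)
    (fun v rec =>
      if h : ∃ a ∈ C, IsDesc G.Adj a v then
        M.f v (fun p => if hp : p.1 ∈ C then c ⟨p.1, hp⟩ else
          rec p.1 ⟨p.2, h.imp fun _ ha => ⟨ha.1, G.time_le_of_isDesc ha.2⟩⟩) (u v)
      else M.obs u v) v

section

variable [Finite ι] {C : Set (Vertex ι)} (hC : C.Finite) (c : ∀ v : C, S v.1.1)
  (u : ∀ v, M.Exo v)

theorem natSol_of_isDesc {v : Vertex ι} (h : ∃ a ∈ C, IsDesc G.Adj a v) :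
    M.natSol hC c u v = M.f v (fun p => override c (M.natSol hC c u) p.1) (u v) := by
  rw [natSol, WellFounded.fix_eq, dif_pos h]
  rfl

theorem natSol_of_not_isDesc {v : Vertex ι} (h : ∀ a ∈ C, ¬ IsDesc G.Adj a v) :
    M.natSol hC c u v = M.obs u v := by
  rw [natSol, WellFounded.fix_eq, dif_neg (by push Not; exact h)]

/-- A non-descendant of `C` has only parents that are outside `C` and keep their observed values, so
its observed equation is already the required one. -/
theorem natSol_eq {u : ∀ v, M.Exo v} (hu : M.Solves u) (v : Vertex ι) :
    M.natSol hC c u v = M.f v (fun p => override c (M.natSol hC c u) p.1) (u v) := by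
  by_cases h : ∃ a ∈ C, IsDesc G.Adj a v
  · exact M.natSol_of_isDesc hC c u h
  · push Not at h
    rw [M.natSol_of_not_isDesc hC c u h, hu v]
    congr 1
    funext p
    rw [override_of_notMem _ _ fun hp => h p.1 hp (.single p.2),
      M.natSol_of_not_isDesc hC c u fun a ha hap => h a ha (hap.tail p.2)]

theorem natSol_empty (c : ∀ v : (∅ : Set (Vertex ι)), S v.1.1) :
    M.natSol Set.finite_empty c u = M.obs u :=
  funext fun _ => M.natSol_of_not_isDesc _ _ _ fun _ ha => absurd ha (Set.notMem_empty _)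

theorem doSol_eq_override {u : ∀ v, M.Exo v} (hu : M.Solves u) (v : Vertex ι) :
    M.doSol hC c u v = override c (M.natSol hC c u) v := by
  induction v using (G.wellFounded_prec hC).induction with
  | _ v ih =>
    by_cases h : v ∈ C
    · rw [M.doSol_of_mem hC c u h, override_of_mem _ _ h]
    rw [override_of_notMem _ _ h]
    by_cases h' : ∃ a ∈ C, a.2 ≤ v.2
    · rw [M.doSol_of_notMem hC c u h h', M.natSol_eq hC c hu]
      congr 1
      funext p
      exact ih p.1 ⟨p.2, h'⟩
    · push Not at h'
      rw [M.doSol_of_before hC c u h', M.natSol_of_not_isDesc hC c u fun a ha hav =>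
        absurd (G.time_le_of_isDesc hav) (not_le.2 (h' a ha))]

/-- Consistency: intervening on further vertices has no effect where these naturally take the
prescribed values. -/
theorem natSol_eq_natSol {C' : Set (Vertex ι)} (hC' : C'.Finite) (c' : ∀ v : C', S v.1.1)
    (hCC' : C ⊆ C') (hc : ∀ v (h : v ∈ C), c ⟨v, h⟩ = c' ⟨v, hCC' h⟩)
    {u : ∀ v, M.Exo v} (hu : M.Solves u)
    (h : (∀ v (h : v ∈ C'), v ∉ C → M.natSol hC c u v = c' ⟨v, h⟩) ∨
      (∀ v (h : v ∈ C'), v ∉ C → M.natSol hC' c' u v = c' ⟨v, h⟩)) :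
    M.natSol hC c u = M.natSol hC' c' u := by
  funext v
  induction v using (G.wellFounded_prec hC').induction with
  | _ v ih =>
    by_cases h' : ∃ a ∈ C', IsDesc G.Adj a v
    · rw [M.natSol_eq hC c hu, M.natSol_eq hC' c' hu]
      congr 1
      funext p
      have ihp := ih p.1 ⟨p.2, h'.imp fun _ ha => ⟨ha.1, G.time_le_of_isDesc ha.2⟩⟩
      by_cases hp : p.1 ∈ C
      · rw [override_of_mem _ _ hp, override_of_mem _ _ (hCC' hp), hc]
      rw [override_of_notMem _ _ hp]
      -- At a parent in `C' \ C` only the larger intervention prescribes a value; `h` supplies the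
      -- same value for the smaller one, directly or through the induction hypothesis.
      by_cases hp' : p.1 ∈ C'
      · rw [override_of_mem _ _ hp']
        rcases h with h | h
        · exact h _ hp' hp
        · exact ihp.trans (h _ hp' hp)
      · rw [override_of_notMem _ _ hp', ihp]
    · push Not at h'
      rw [M.natSol_of_not_isDesc hC c u fun a ha => h' a (hCC' ha),
        M.natSol_of_not_isDesc hC' c' u h']

/-- Natural values are measurable for any σ-algebra that contains the noise and the observations
they are computed from. -/
theorem measurable_natSol_of (m : MeasurableSpace (∀ v, M.Exo v)) (T : Set (Vertex ι))
    (hT : ∀ v ∈ T, (∃ a ∈ C, IsDesc G.Adj a v) → ∀ p, G.Adj p v → p ∉ C → p ∈ T)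
    (hobs : ∀ v ∈ T, (∀ a ∈ C, ¬ IsDesc G.Adj a v) → Measurable[m] fun u => M.obs u v)
    (hexo : ∀ v ∈ T, (∃ a ∈ C, IsDesc G.Adj a v) → Measurable[m] fun u => u v)
    (v : Vertex ι) (hv : v ∈ T) : Measurable[m] fun u => M.natSol hC c u v := by
  induction v using (G.wellFounded_prec hC).induction with
  | _ v ih =>
    by_cases h : ∃ a ∈ C, IsDesc G.Adj a v
    · have hpar : ∀ p : G.parents v, Measurable[m] fun u => override c (M.natSol hC c u) p.1 := by
        intro p
        by_cases hp : p.1 ∈ C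
        · simp only [override_of_mem _ _ hp]
          exact measurable_const
        · simp only [override_of_notMem _ _ hp]
          exact ih p.1 ⟨p.2, h.imp fun _ ha => ⟨ha.1, G.time_le_of_isDesc ha.2⟩⟩
            (hT v hv h p.1 p.2 hp)
      simp only [M.natSol_of_isDesc hC c _ h]
      exact (M.measurable_f v).comp ((measurable_pi_lambda _ hpar).prodMk (hexo v hv h))
    · push Not at h
      simp only [M.natSol_of_not_isDesc hC c _ h]
      exact hobs v hv h

end

/-- The σ-algebra of the noise at the vertices of `A`. -/
@[reducible]
def exoSigma (A : Set (Vertex ι)) : MeasurableSpace (∀ v, M.Exo v) :=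
  ⨆ a ∈ A, MeasurableSpace.comap (fun u => u a) inferInstance

theorem measurable_exo {A : Set (Vertex ι)} {a : Vertex ι} (ha : a ∈ A) :
    Measurable[M.exoSigma A] fun u => u a :=
  Measurable.of_comap_le (le_iSup₂_of_le (f := fun a (_ : a ∈ A) =>
    MeasurableSpace.comap (fun u : ∀ v, M.Exo v => u a) inferInstance) a ha le_rfl)

theorem exoSigma_le (A : Set (Vertex ι)) : M.exoSigma A ≤ MeasurableSpace.pi :=
  iSup₂_le fun a _ => (measurable_pi_apply a).comap_le

theorem measurable_obs_exoSigma {A : Set (Vertex ι)} {v : Vertex ι}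
    (h : ∀ a, IsDesc G.Adj a v → a ∈ A) : Measurable[M.exoSigma A] fun u => M.obs u v :=
  (M.measurable_sol v).comp
    (@measurable_pi_lambda _ _ _ (M.exoSigma A) _ _ fun a => M.measurable_exo (h a.1 a.2))

theorem indep_exoSigma {A B : Set (Vertex ι)} (h : Disjoint A B) :
    Indep (M.exoSigma A) (M.exoSigma B) M.exoLaw :=
  indep_iSup_of_disjoint (fun a => (measurable_pi_apply a).comap_le)
    (iIndepFun_infinitePi (P := M.exo) (X := fun _ => id) fun _ => measurable_id) h

theorem exoSigma_mono {A B : Set (Vertex ι)} (h : A ⊆ B) : M.exoSigma A ≤ M.exoSigma B :=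
  iSup₂_le fun _ ha => (M.measurable_exo (h ha)).comap_le

/-- The recursion stops at `C`. At a non-descendant of `C` the observed value uses the noise of all
ancestors, but the directed paths from these avoid `C`, so they still lie in `reach`. -/
theorem measurable_natSol_exoSigma [Finite ι] {C : Set (Vertex ι)} (hC : C.Finite)
    (c : ∀ v : C, S v.1.1) (v : Vertex ι) :
    Measurable[M.exoSigma (reach G.Adj C v)] fun u => M.natSol hC c u v := by
  refine M.measurable_natSol_of hC c _ (reach G.Adj C v)
    (fun w hw _ p hp hpC => reach_of_adj hw hp hpC) ?_ (fun w hw _ => M.measurable_exo hw) v .refl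
  refine fun w hw hwC => M.measurable_obs_exoSigma fun a ha => ?_
  exact Relation.ReflTransGen.trans (IsDesc.avoiding ha hwC) hw

theorem measurable_natSol [Finite ι] {C : Set (Vertex ι)} (hC : C.Finite)
    (c : ∀ v : C, S v.1.1) : Measurable (M.natSol hC c) :=
  measurable_pi_lambda _ fun v => (M.measurable_natSol_exoSigma hC c v).mono (M.exoSigma_le _) le_rfl

end DSCM

/-! ### Measurability of events -/

section Events

variable {ι : Type*} {S : ι → Type*}

theorem mem_event_iff {A : Set (Vertex ι)} (a : ∀ v : A, S v.1.1) (w : ∀ v : Vertex ι, S v.1) :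
    w ∈ event a ↔ ∀ v (h : v ∈ A), w v = a ⟨v, h⟩ :=
  ⟨fun h v hv => congrFun h ⟨v, hv⟩, fun h => funext fun v => h v.1 v.2⟩

variable [Finite ι] [∀ i, MeasurableSpace (S i)] [∀ i, DiscreteMeasurableSpace (S i)]

/-- Even for infinite `A` the intersection is countable, since there are countably many vertices. -/
theorem measurableSet_preimage_event {Ω : Type*} (m : MeasurableSpace Ω)
    {N : Ω → ∀ v : Vertex ι, S v.1} {A : Set (Vertex ι)} (a : ∀ v : A, S v.1.1)
    (h : ∀ v ∈ A, Measurable[m] fun u => N u v) : MeasurableSet[m] (N ⁻¹' event a) := by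
  have heq : N ⁻¹' event a = ⋂ v : A, (fun u => N u v) ⁻¹' {a v} := by
    ext u
    simp only [Set.mem_preimage, mem_event_iff, Set.mem_iInter, Set.mem_singleton_iff,
      Subtype.forall]
  rw [heq]
  exact MeasurableSet.iInter fun v => h v.1 v.2 (MeasurableSet.of_discrete)

theorem measurableSet_event {A : Set (Vertex ι)} (a : ∀ v : A, S v.1.1) :
    MeasurableSet (event a) :=
  measurableSet_preimage_event _ (N := id) a fun v _ => measurable_pi_apply v

end Events

/-! ### Consistency and the adjustment formula for finite `Z` -/

namespace DSCM

variable {ι : Type*} {G : FTCG ι} {S : ι → Type*} [∀ i, MeasurableSpace (S i)] (M : DSCM G S)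

theorem P_apply {s : Set (∀ v : Vertex ι, S v.1)} (hs : MeasurableSet s) :
    M.P s = M.exoLaw (M.obs ⁻¹' s) := Measure.map_apply M.measurable_obs hs

variable [Finite ι] {X Y Z : Set (Vertex ι)} (hX : X.Finite) (x : ∀ v : X, S v.1.1)

/-- Where the natural values of the intervened vertices are the prescribed ones, nothing is
changed by the intervention. -/
theorem obs_mem_event_iff {u : ∀ v, M.Exo v} (hu : M.Solves u) :
    M.obs u ∈ event x ↔ M.natSol hX x u ∈ event x := by
  have h := M.natSol_eq_natSol Set.finite_empty (fun v => absurd v.2 (Set.notMem_empty _)) hX x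
    (Set.empty_subset _) (fun _ h => absurd h (Set.notMem_empty _)) hu
  rw [natSol_empty] at h
  constructor
  · intro h1
    rwa [← h (.inl fun v hv _ => (mem_event_iff _ _).1 h1 v hv)]
  · intro h1
    rwa [h (.inr fun v hv _ => (mem_event_iff _ _).1 h1 v hv)]

theorem obs_eq_natSol {u : ∀ v, M.Exo v} (hu : M.Solves u) (h : M.natSol hX x u ∈ event x) :
    M.obs u = M.natSol hX x u := by
  have h' := M.natSol_eq_natSol Set.finite_empty (fun v => absurd v.2 (Set.notMem_empty _)) hX x
    (Set.empty_subset _) (fun _ h => absurd h (Set.notMem_empty _)) hu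
    (.inr fun v hv _ => (mem_event_iff _ _).1 h v hv)
  rwa [natSol_empty] at h'

theorem doSol_mem_event_iff (hXY : Disjoint X Y) (y : ∀ v : Y, S v.1.1) {u : ∀ v, M.Exo v}
    (hu : M.Solves u) : M.doSol hX x u ∈ event y ↔ M.natSol hX x u ∈ event y := by
  simp only [mem_event_iff]
  refine forall₂_congr fun v hv => ?_
  rw [M.doSol_eq_override hX x hu, override_of_notMem _ _ fun h => hXY.le_bot ⟨h, hv⟩]

theorem proj_natSol_eq_proj_obs (hZ : ∀ z ∈ Z, ∀ x ∈ X, ¬ IsDesc G.Adj x z)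
    (u : ∀ v, M.Exo v) : proj Z (M.natSol hX x u) = proj Z (M.obs u) :=
  funext fun v => M.natSol_of_not_isDesc hX x u (hZ v.1 v.2)

variable [∀ i, DiscreteMeasurableSpace (S i)]

theorem doP_event (hXY : Disjoint X Y) (y : ∀ v : Y, S v.1.1) :
    M.doP hX x (event y) = M.exoLaw (M.natSol hX x ⁻¹' event y) := by
  rw [doP, Measure.map_apply (M.measurable_doSol hX x) (measurableSet_event y)]
  refine measure_congr ?_
  filter_upwards [M.ae_solves] with u hu
  exact propext (M.doSol_mem_event_iff hX x hXY y hu)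

/-- Observing `X = x` is the same as the natural values of `X` being `x` under `do(X = x)`. -/
theorem P_event_inter {s : Set (∀ v : Vertex ι, S v.1)} (hs : MeasurableSet s) :
    M.P (event x ∩ s) = M.exoLaw (M.natSol hX x ⁻¹' (event x ∩ s)) := by
  rw [M.P_apply ((measurableSet_event x).inter hs)]
  refine measure_congr ?_
  filter_upwards [M.ae_solves] with u hu
  refine propext ⟨fun h => ?_, fun h => ?_⟩
  · have h1 := (M.obs_mem_event_iff hX x hu).1 h.1
    change M.natSol hX x u ∈ _
    rwa [← M.obs_eq_natSol hX x hu h1]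
  · change M.obs u ∈ _
    rwa [M.obs_eq_natSol hX x hu h.1]

/-- For finite `Z` the natural values of `X` and the values of `Y` under `do(X = x)` are
conditionally independent given `Z`. -/
theorem natSol_condIndep_of_finite (hZ : Backdoor G.Adj X Y Z) (hZf : Z.Finite)
    (y : ∀ v : Y, S v.1.1) (z : ∀ v : Z, S v.1.1) :
    M.exoLaw (M.natSol hX x ⁻¹' (event x ∩ (event z ∩ event y))) *
        M.exoLaw (M.natSol hX x ⁻¹' event z) =
      M.exoLaw (M.natSol hX x ⁻¹' (event x ∩ event z)) *
        M.exoLaw (M.natSol hX x ⁻¹' (event z ∩ event y)) := by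
  set L := linked G.Adj X Z
  have hXZ : ∀ v ∈ Z, v ∉ X := fun v hv hvX => hZ.disjoint_ZX.le_bot ⟨hv, hvX⟩
  -- Fixing `Z` to `z` as well cuts the flow of noise through `Z`. By consistency (`hcons`) this
  -- changes nothing on the event `Z = z`, to which all four probabilities are confined.
  let n' := M.natSol (hX.union hZf) (glue x z)
  let z1 : ∀ v : L, S v.1.1 := fun v => z ⟨v.1, v.2.1⟩
  let z2 : ∀ v : (Z \ L : Set (Vertex ι)), S v.1.1 := fun v => z ⟨v.1, v.2.1⟩
  have hz12 : ∀ w, w ∈ event z ↔ w ∈ event z1 ∧ w ∈ event z2 := by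
    intro w
    simp only [mem_event_iff]
    constructor
    · exact fun h => ⟨fun v hv => h v hv.1, fun v hv => h v hv.1⟩
    · rintro ⟨h1, h2⟩ v hv
      by_cases hvL : v ∈ L
      · exact h1 v hvL
      · exact h2 v ⟨hv, hvL⟩
  have hcons : ∀ u, M.Solves u → (M.natSol hX x u ∈ event z ∨ n' u ∈ event z) →
      M.natSol hX x u = n' u := by
    intro u hu h
    refine M.natSol_eq_natSol hX x (hX.union hZf) (glue x z) Set.subset_union_left
      (fun v hv => by rw [glue, dif_pos hv]) hu (h.imp ?_ ?_)
    all_goals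
      intro h v hv hvX
      rw [glue, dif_neg hvX]
      exact (mem_event_iff _ _).1 h v _
  have hmeas : ∀ (s : Set (Vertex ι)) (A : Set (Vertex ι)) (a : ∀ v : A, S v.1.1),
      (∀ v ∈ A, reach G.Adj (X ∪ Z) v ⊆ s) → MeasurableSet[M.exoSigma s] (n' ⁻¹' event a) :=
    fun s A a h => measurableSet_preimage_event _ a fun v hv =>
      (M.measurable_natSol_exoSigma (hX.union hZf) (glue x z) v).mono (M.exoSigma_mono (h v hv))
        le_rfl
  have hind := (Indep_iff _ _ _).1 (M.indep_exoSigma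
    (disjoint_compl_right (a := side G.Adj X Z)))
  have hx := hmeas _ X x fun v hv => hZ.reach_subset_side G.asymm (.inl hv)
  have hz1 := hmeas _ L z1 fun v hv => hZ.reach_subset_side G.asymm (.inr hv)
  have hy := hmeas _ Y y fun v hv => hZ.reach_subset_compl_side G.asymm (.inl hv)
  have hz2 := hmeas _ _ z2 fun v hv => hZ.reach_subset_compl_side G.asymm (.inr hv)
  have hcongr : ∀ s t : Set (∀ v : Vertex ι, S v.1),
      (∀ w, w ∈ s ↔ w ∈ event z ∧ w ∈ t) →
      M.exoLaw (M.natSol hX x ⁻¹' s) = M.exoLaw (n' ⁻¹' s) := by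
    intro s t hst
    refine measure_congr ?_
    filter_upwards [M.ae_solves] with u hu
    refine propext ⟨fun h => ?_, fun h => ?_⟩
    · change n' u ∈ s
      rwa [← hcons u hu (.inl ((hst _).1 h).1)]
    · change M.natSol hX x u ∈ s
      rwa [hcons u hu (.inr ((hst _).1 h).1)]
  rw [hcongr _ (event x ∩ event y) fun w => by simp only [Set.mem_inter_iff]; tauto,
    hcongr (event z) Set.univ fun w => by simp,
    hcongr (event x ∩ event z) (event x) fun w => by simp only [Set.mem_inter_iff]; tauto,
    hcongr (event z ∩ event y) (event y) fun w => by simp only [Set.mem_inter_iff]]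
  have e1 : n' ⁻¹' (event x ∩ (event z ∩ event y)) =
      (n' ⁻¹' event x ∩ n' ⁻¹' event z1) ∩ (n' ⁻¹' event z2 ∩ n' ⁻¹' event y) := by
    ext u
    simp only [Set.mem_inter_iff, Set.mem_preimage, hz12]
    tauto
  have e2 : n' ⁻¹' event z = n' ⁻¹' event z1 ∩ n' ⁻¹' event z2 := by
    ext u
    simp only [Set.mem_inter_iff, Set.mem_preimage, hz12]
  have e3 : n' ⁻¹' (event x ∩ event z) =
      (n' ⁻¹' event x ∩ n' ⁻¹' event z1) ∩ n' ⁻¹' event z2 := by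
    ext u
    simp only [Set.mem_inter_iff, Set.mem_preimage, hz12]
    tauto
  have e4 : n' ⁻¹' (event z ∩ event y) =
      n' ⁻¹' event z1 ∩ (n' ⁻¹' event z2 ∩ n' ⁻¹' event y) := by
    ext u
    simp only [Set.mem_inter_iff, Set.mem_preimage, hz12]
    tauto
  -- Both sides become the product of the probabilities of `(x, z1)`, `(z2, y)`, `z1` and `z2`.
  rw [e1, e2, e3, e4, hind _ _ (hx.inter hz1) (hz2.inter hy), hind _ _ hz1 hz2,
    hind _ _ (hx.inter hz1) hz2, hind _ _ hz1 (hz2.inter hy)]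
  ring

/-- The backdoor adjustment for a finite set `Z`. -/
theorem doP_event_eq_tsum [∀ i, Countable (S i)] (hZ : Backdoor G.Adj X Y Z) (hZf : Z.Finite)
    (y : ∀ v : Y, S v.1.1)
    (hpos : ∀ z : ∀ v : Z, S v.1.1, M.P (event z) ≠ 0 → M.P (event x ∩ event z) ≠ 0) :
    M.doP hX x (event y) =
      ∑' z : ∀ v : Z, S v.1.1, M.P[event y | event x ∩ event z] * M.P (event z) := by
  have : Finite Z := hZf
  have hpart : M.natSol hX x ⁻¹' event y =
      ⋃ z : ∀ v : Z, S v.1.1, M.natSol hX x ⁻¹' (event z ∩ event y) := by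
    ext u
    simp [event]
  rw [M.doP_event hX x hZ.disjoint_XY, hpart, measure_iUnion]
  · refine tsum_congr fun z => ?_
    have hz : M.P (event z) = M.exoLaw (M.natSol hX x ⁻¹' event z) := by
      rw [M.P_apply (measurableSet_event z)]
      congr 1
      ext u
      simp only [event, Set.mem_preimage, Set.mem_ofPred_eq,
        M.proj_natSol_eq_proj_obs hX x hZ.not_desc]
    have hci := M.natSol_condIndep_of_finite hX x hZ hZf y z
    rw [← M.P_event_inter hX x ((measurableSet_event z).inter (measurableSet_event y)),
      ← M.P_event_inter hX x (measurableSet_event z), ← hz] at hci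
    rw [cond_apply ((measurableSet_event x).inter (measurableSet_event z)), Set.inter_assoc]
    by_cases h0 : M.P (event z) = 0
    · rw [h0, mul_zero]
      exact measure_mono_null (Set.preimage_mono Set.inter_subset_left) (hz ▸ h0)
    · rw [mul_assoc, hci, ← mul_assoc, ENNReal.inv_mul_cancel (hpos z h0) (measure_ne_top _ _),
        one_mul]
  · intro z z' hzz'
    refine Set.disjoint_left.2 fun u hu hu' => hzz' ?_
    exact hu.1.symm.trans hu'.1
  · exact fun z => M.measurable_natSol hX x
      ((measurableSet_event z).inter (measurableSet_event y))

end DSCM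

/-! ### Conditional independence in the presence of additional independent noise -/

section Mixture

open scoped ENNReal

variable {Ω γ β β' δ δ' : Type*} [MeasurableSpace Ω] [MeasurableSpace γ] [MeasurableSpace β]
  [MeasurableSpace β'] [MeasurableSpace δ] [MeasurableSpace δ'] {μ : Measure Ω}
  [IsProbabilityMeasure μ] {k : Ω → γ} {f : Ω → β} {g : Ω → β'} {U : Ω → δ} {U' : Ω → δ'}
  {κ : Kernel γ β} {κ' : Kernel γ β'} [IsMarkovKernel κ] [IsMarkovKernel κ']

/-- If `f` and `g` are conditionally independent given `k`, and `U`, `U'` are independent of these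
and of each other, then `(f, U)` and `(g, U')` are conditionally independent given `k`. -/
theorem lintegral_mul_of_condIndep (hk : Measurable k) (hf : Measurable f) (hg : Measurable g)
    (hU : Measurable U) (hU' : Measurable U')
    (hlaw : μ.map (fun ω => (k ω, f ω, g ω)) = (μ.map k) ⊗ₘ (κ ×ₖ κ'))
    (hind : IndepFun (fun ω => (k ω, f ω, g ω)) (fun ω => (U ω, U' ω)) μ) (hindU : IndepFun U U' μ)
    {φ : γ × β × δ → ℝ≥0∞} {ψ : γ × β' × δ' → ℝ≥0∞} (hφ : Measurable φ) (hψ : Measurable ψ) :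
    ∫⁻ ω, φ (k ω, f ω, U ω) * ψ (k ω, g ω, U' ω) ∂μ =
      ∫⁻ z, (∫⁻ b, ∫⁻ d, φ (z, b, d) ∂(μ.map U) ∂(κ z)) *
        (∫⁻ b, ∫⁻ d, ψ (z, b, d) ∂(μ.map U') ∂(κ' z)) ∂(μ.map k) := by
  have : IsProbabilityMeasure (μ.map U) := Measure.isProbabilityMeasure_map hU.aemeasurable
  have : IsProbabilityMeasure (μ.map U') := Measure.isProbabilityMeasure_map hU'.aemeasurable
  have : IsProbabilityMeasure (μ.map k) := Measure.isProbabilityMeasure_map hk.aemeasurable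
  have hV : Measurable fun ω => (k ω, f ω, g ω) := by fun_prop
  have hW : Measurable fun ω => (U ω, U' ω) := by fun_prop
  have hjoint := (indepFun_iff_map_prod_eq_prod_map_map hV.aemeasurable hW.aemeasurable).1 hind
  rw [(indepFun_iff_map_prod_eq_prod_map_map hU.aemeasurable hU'.aemeasurable).1 hindU, hlaw]
    at hjoint
  have hφ' : Measurable fun q : γ × β => ∫⁻ d, φ (q.1, q.2, d) ∂(μ.map U) :=
    Measurable.lintegral_prod_right' (f := fun q : (γ × β) × δ => φ (q.1.1, q.1.2, q.2))
      (by fun_prop)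
  have hψ' : Measurable fun q : γ × β' => ∫⁻ d, ψ (q.1, q.2, d) ∂(μ.map U') :=
    Measurable.lintegral_prod_right' (f := fun q : (γ × β') × δ' => ψ (q.1.1, q.1.2, q.2))
      (by fun_prop)
  let Φ : (γ × β × β') × (δ × δ') → ℝ≥0∞ := fun q =>
    φ (q.1.1, q.1.2.1, q.2.1) * ψ (q.1.1, q.1.2.2, q.2.2)
  have hΦ : Measurable Φ := by
    change Measurable fun q : (γ × β × β') × (δ × δ') =>
      φ (q.1.1, q.1.2.1, q.2.1) * ψ (q.1.1, q.1.2.2, q.2.2)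
    fun_prop
  have h1 : ∫⁻ ω, φ (k ω, f ω, U ω) * ψ (k ω, g ω, U' ω) ∂μ =
      ∫⁻ q, Φ q ∂(μ.map fun ω => ((k ω, f ω, g ω), (U ω, U' ω))) :=
    (lintegral_map hΦ (hV.prodMk hW)).symm
  have h2 : ∀ v : γ × β × β', ∫⁻ d, Φ (v, d) ∂((μ.map U).prod (μ.map U')) =
      (∫⁻ d, φ (v.1, v.2.1, d) ∂(μ.map U)) * ∫⁻ d, ψ (v.1, v.2.2, d) ∂(μ.map U') := fun v =>
    lintegral_prod_mul (f := fun d => φ (v.1, v.2.1, d)) (g := fun d => ψ (v.1, v.2.2, d))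
      (by fun_prop) (by fun_prop)
  rw [h1, hjoint, lintegral_prod _ hΦ.aemeasurable]
  simp only [h2]
  rw [Measure.lintegral_compProd]
  · refine lintegral_congr fun z => ?_
    rw [Kernel.prod_apply]
    exact lintegral_prod_mul (f := fun b => ∫⁻ d, φ (z, b, d) ∂(μ.map U))
      (g := fun b => ∫⁻ d, ψ (z, b, d) ∂(μ.map U'))
      (hφ'.comp measurable_prodMk_left).aemeasurable (hψ'.comp measurable_prodMk_left).aemeasurable
  · exact (hφ'.comp (measurable_fst.prodMk (measurable_fst.comp measurable_snd))).mul
      (hψ'.comp (measurable_fst.prodMk (measurable_snd.comp measurable_snd)))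

/-- A version of the conditional probability of an event that depends on `(k, g, U')` given `k`
is also its conditional probability given `(k, f, U)`. -/
theorem exists_condProb_of_condIndep (hk : Measurable k) (hf : Measurable f) (hg : Measurable g)
    (hU : Measurable U) (hU' : Measurable U')
    (hlaw : μ.map (fun ω => (k ω, f ω, g ω)) = (μ.map k) ⊗ₘ (κ ×ₖ κ'))
    (hind : IndepFun (fun ω => (k ω, f ω, g ω)) (fun ω => (U ω, U' ω)) μ) (hindU : IndepFun U U' μ)
    {A : Set (γ × β' × δ')} (hA : MeasurableSet A) :
    ∃ G : γ → ℝ≥0∞, Measurable G ∧ ∀ B : Set (γ × β × δ), MeasurableSet B →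
      μ ((fun ω => (k ω, f ω, U ω)) ⁻¹' B ∩ (fun ω => (k ω, g ω, U' ω)) ⁻¹' A) =
        ∫⁻ ω in (fun ω => (k ω, f ω, U ω)) ⁻¹' B, G (k ω) ∂μ := by
  have : IsProbabilityMeasure (μ.map U') := Measure.isProbabilityMeasure_map hU'.aemeasurable
  let G : γ → ℝ≥0∞ := fun z => ∫⁻ b, ∫⁻ d, A.indicator 1 (z, b, d) ∂(μ.map U') ∂(κ' z)
  have hA1 : Measurable (A.indicator (1 : γ × β' × δ' → ℝ≥0∞)) := measurable_one.indicator hA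
  have hG : Measurable G := by
    have h1 : Measurable fun q : γ × β' => ∫⁻ d, A.indicator (1 : γ × β' × δ' → ℝ≥0∞)
        (q.1, q.2, d) ∂(μ.map U') :=
      Measurable.lintegral_prod_right' (f := fun q : (γ × β') × δ' =>
        A.indicator (1 : γ × β' × δ' → ℝ≥0∞) (q.1.1, q.1.2, q.2)) (by fun_prop)
    exact Measurable.lintegral_kernel_prod_right' h1
  refine ⟨G, hG, fun B hB => ?_⟩
  have hB1 : Measurable (B.indicator (1 : γ × β × δ → ℝ≥0∞)) := measurable_one.indicator hB
  have hk1 : Measurable fun ω => (k ω, f ω, U ω) := by fun_prop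
  have hk2 : Measurable fun ω => (k ω, g ω, U' ω) := by fun_prop
  -- The indicator of `A` and the function `G` of `k` have the same integral against `κ' z` and the
  -- law of `U'`, so they are interchangeable against every `B`.
  have e1 := lintegral_mul_of_condIndep hk hf hg hU hU' hlaw hind hindU hB1 hA1
  have e2 := lintegral_mul_of_condIndep hk hf hg hU hU' hlaw hind hindU hB1
    (ψ := fun q => G q.1) (by fun_prop)
  simp only [lintegral_const, measure_univ, mul_one] at e2
  rw [← lintegral_indicator_one ((hk1 hB).inter (hk2 hA)), ← lintegral_indicator (hk1 hB)]
  refine Eq.trans ?_ ((e1.trans e2.symm).trans ?_)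
  · refine lintegral_congr fun ω => ?_
    by_cases h1 : (k ω, f ω, U ω) ∈ B <;> by_cases h2 : (k ω, g ω, U' ω) ∈ A <;>
      simp [Set.indicator, h1, h2]
  · refine lintegral_congr fun ω => ?_
    by_cases h1 : (k ω, f ω, U ω) ∈ B <;> simp [Set.indicator, h1]

end Mixture

/-- The descendants of `X` that influence some vertex of `V` without passing through `X ∪ Z`. -/
def core {α : Type*} (E : α → α → Prop) (X Z V : Set α) : Set α :=
  {a | (∃ x ∈ X, IsDesc E x a) ∧ ∃ v ∈ V, a ∈ reach E (X ∪ Z) v}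

/-! ### The adjustment formula for arbitrary `Z` -/

namespace DSCM

variable {ι : Type*} {G : FTCG ι} {S : ι → Type*} [∀ i, MeasurableSpace (S i)] (M : DSCM G S)

/-- The noise at the vertices of `A`. -/
def noise (A : Set (Vertex ι)) (u : ∀ v, M.Exo v) (a : A) : M.Exo a.1 := u a.1

theorem measurable_noise (A : Set (Vertex ι)) : Measurable[M.exoSigma A] (M.noise A) :=
  @measurable_pi_lambda _ _ _ (M.exoSigma A) _ _ fun a => M.measurable_exo a.2

theorem measurable_noise' (A : Set (Vertex ι)) : Measurable (M.noise A) :=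
  (M.measurable_noise A).mono (M.exoSigma_le A) le_rfl

theorem measurable_proj_obs (A : Set (Vertex ι)) : Measurable fun u => proj A (M.obs u) :=
  (measurable_proj A).comp M.measurable_obs

theorem indepFun_of_exoSigma {A B : Set (Vertex ι)} (h : Disjoint A B) {β β' : Type*}
    [MeasurableSpace β] [MeasurableSpace β'] {f : (∀ v, M.Exo v) → β} {g : (∀ v, M.Exo v) → β'}
    (hf : Measurable[M.exoSigma A] f) (hg : Measurable[M.exoSigma B] g) :
    IndepFun f g M.exoLaw :=
  (IndepFun_iff_Indep _ _ _).2
    (indep_of_indep_of_le_left (indep_of_indep_of_le_right (M.indep_exoSigma h) hg.comap_le)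
      hf.comap_le)

theorem map_P {β : Type*} [MeasurableSpace β] {q : (∀ v : Vertex ι, S v.1) → β}
    (hq : Measurable q) : M.P.map q = M.exoLaw.map fun u => q (M.obs u) :=
  Measure.map_map hq M.measurable_obs

variable {X Y Z : Set (Vertex ι)}

/-- The data that determine the natural values of `V` under an intervention on `X`. -/
def context (X Z V : Set (Vertex ι)) (u : ∀ v, M.Exo v) :
    (∀ v : Z, S v.1.1) × (∀ v : past G.Adj X Z V, S v.1.1) ×
      (∀ a : core G.Adj X Z V, M.Exo a.1) :=
  (proj Z (M.obs u), proj _ (M.obs u), M.noise _ u)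

variable [Finite ι] [∀ i, DiscreteMeasurableSpace (S i)]

/-- The recursion for `V` is traced back to `X`, to `Z`, or to non-descendants of `X`, whose
observed values are known; noise is needed only at the descendants of `X` met on the way, the core.
-/
theorem exists_context_preimage (hX : X.Finite) (x : ∀ v : X, S v.1.1)
    (hZ : ∀ z ∈ Z, ∀ x ∈ X, ¬ IsDesc G.Adj x z) {V : Set (Vertex ι)} (a : ∀ v : V, S v.1.1) :
    ∃ A, MeasurableSet A ∧ M.context X Z V ⁻¹' A = M.natSol hX x ⁻¹' event a := by
  let m : MeasurableSpace (∀ v, M.Exo v) := MeasurableSpace.comap (M.context X Z V) inferInstance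
  have hc : Measurable[m] (M.context X Z V) := comap_measurable _
  suffices h : ∀ v ∈ V, Measurable[m] fun u => M.natSol hX x u v from
    measurableSet_preimage_event m a h
  -- `Z` is adjoined because only `X` is intervened on: parents in `Z` are visited, but as
  -- non-descendants of `X` they end the recursion with an observed value.
  have hT := M.measurable_natSol_of hX x m ((⋃ v ∈ V, reach G.Adj (X ∪ Z) v) ∪ Z) ?_ ?_ ?_
  · exact fun v hv => hT v (.inl (Set.mem_biUnion hv .refl))
  · intro v hv hd p hp hpX
    by_cases hpZ : p ∈ Z
    · exact .inr hpZ
    rcases hv with hv | hv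
    · obtain ⟨w, hw, hvw⟩ := Set.mem_iUnion₂.1 hv
      exact .inl (Set.mem_biUnion hw (reach_of_adj hvw hp fun h => h.elim hpX hpZ))
    · obtain ⟨b, hb, hbv⟩ := hd
      exact absurd hbv (hZ v hv b hb)
  · intro v hv hd
    rcases hv with hv | hv
    · obtain ⟨w, hw, hvw⟩ := Set.mem_iUnion₂.1 hv
      exact (measurable_pi_apply (⟨v, hd, w, hw, hvw⟩ : past G.Adj X Z V)).comp
        ((measurable_fst.comp measurable_snd).comp hc)
    · exact (measurable_pi_apply (⟨v, hv⟩ : Z)).comp (measurable_fst.comp hc)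
  · intro v hv hd
    rcases hv with hv | hv
    · obtain ⟨w, hw, hvw⟩ := Set.mem_iUnion₂.1 hv
      exact (measurable_pi_apply (⟨v, hd, w, hw, hvw⟩ : core G.Adj X Z V)).comp
        ((measurable_snd.comp measurable_snd).comp hc)
    · obtain ⟨b, hb, hbv⟩ := hd
      exact absurd hbv (hZ v hv b hb)

variable [∀ i, Countable (S i)] [∀ i, Nonempty (S i)]

/-- If `P` is Markov, the natural values of `X` and the values of `Y` under `do(X = x)` are
conditionally independent given `Z`: the conditional probability of `Y = y` given `Z` does not
change on the event `X = x`. -/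
theorem exists_condProb_natSol (hM : IsMarkov G.Adj M.P) (hX : X.Finite) (x : ∀ v : X, S v.1.1)
    (hZ : Backdoor G.Adj X Y Z) (y : ∀ v : Y, S v.1.1) :
    ∃ F : (∀ v : Z, S v.1.1) → ENNReal, Measurable F ∧ ∀ B, MeasurableSet B →
      M.exoLaw (M.natSol hX x ⁻¹' (proj Z ⁻¹' B ∩ event y)) =
        ∫⁻ u in M.natSol hX x ⁻¹' (proj Z ⁻¹' B), F (proj Z (M.obs u)) ∂M.exoLaw ∧
      M.exoLaw (M.natSol hX x ⁻¹' (event x ∩ (proj Z ⁻¹' B ∩ event y))) =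
        ∫⁻ u in M.natSol hX x ⁻¹' (event x ∩ proj Z ⁻¹' B), F (proj Z (M.obs u)) ∂M.exoLaw := by
  have hreach : Disjoint (⋃ v ∈ X, reach G.Adj (X ∪ Z) v) (⋃ v ∈ Y, reach G.Adj (X ∪ Z) v) := by
    simp only [Set.disjoint_iUnion_left, Set.disjoint_iUnion_right]
    exact fun v hv w hw => hZ.disjoint_reach G.asymm hw hv
  have hpast : ∀ V, past G.Adj X Z V ⊆ ⋃ v ∈ V, reach G.Adj (X ∪ Z) v :=
    fun V a ⟨_, v, hv, ha⟩ => Set.mem_biUnion hv ha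
  have hcore : ∀ V, core G.Adj X Z V ⊆ ⋃ v ∈ V, reach G.Adj (X ∪ Z) v :=
    fun V a ⟨_, v, hv, ha⟩ => Set.mem_biUnion hv ha
  have hCI := hM (past G.Adj X Z X) (past G.Adj X Z Y) Z (hreach.mono (hpast X) (hpast Y))
    (past_disjoint hZ.disjoint_ZX) (past_disjoint hZ.disjoint_ZY) (hZ.dSep_past G.asymm)
  have hlaw := (condIndepFun_iff_map_prod_eq_prod_condDistrib_prod_condDistrib
    (measurable_proj _) (measurable_proj _) (measurable_proj Z)).1 hCI
  rw [← Measure.compProd_eq_comp_prod, M.map_P (measurable_proj Z), M.map_P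
    ((measurable_proj Z).prodMk ((measurable_proj _).prodMk (measurable_proj _)))] at hlaw
  have hND : ∀ A : Set (Vertex ι), (∀ v ∈ A, ∀ a ∈ X, ¬ IsDesc G.Adj a v) →
      Measurable[M.exoSigma {v | ∀ a ∈ X, ¬ IsDesc G.Adj a v}] fun u => proj A (M.obs u) :=
    fun A hA => @measurable_pi_lambda _ _ _ (M.exoSigma _) _ _ fun v =>
      M.measurable_obs_exoSigma fun b hb a ha hab => hA v.1 v.2 a ha (hab.trans hb)
  -- `Z` and the pasts depend only on noise at non-descendants of `X`, while the cores consist of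
  -- descendants of `X`.
  have hind := M.indepFun_of_exoSigma (A := {v | ∀ a ∈ X, ¬ IsDesc G.Adj a v})
    (B := core G.Adj X Z X ∪ core G.Adj X Z Y) (by
      refine Set.disjoint_left.2 fun v hv hv' => ?_
      rcases hv' with ⟨⟨a, ha, hav⟩, -⟩ | ⟨⟨a, ha, hav⟩, -⟩ <;> exact hv a ha hav)
    (Measurable.prodMk (hND Z hZ.not_desc) (Measurable.prodMk
      (hND (past G.Adj X Z X) fun v hv => hv.1) (hND (past G.Adj X Z Y) fun v hv => hv.1)))
    (Measurable.prodMk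
      ((M.measurable_noise (core G.Adj X Z X)).mono (M.exoSigma_mono Set.subset_union_left) le_rfl)
      ((M.measurable_noise (core G.Adj X Z Y)).mono (M.exoSigma_mono Set.subset_union_right)
        le_rfl))
  have hindU := M.indepFun_of_exoSigma (hreach.mono (hcore X) (hcore Y))
    (M.measurable_noise _) (M.measurable_noise _)
  obtain ⟨A, hA, hA'⟩ := M.exists_context_preimage hX x hZ.not_desc y
  obtain ⟨B₀, hB₀, hB₀'⟩ := M.exists_context_preimage hX x hZ.not_desc x
  obtain ⟨F, hF, hFB⟩ := exists_condProb_of_condIndep (M.measurable_proj_obs Z)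
    (M.measurable_proj_obs _) (M.measurable_proj_obs _) (M.measurable_noise' _)
    (M.measurable_noise' _) hlaw hind hindU hA
  have hB : ∀ B : Set (∀ v : Z, S v.1.1),
      M.context X Z X ⁻¹' (Prod.fst ⁻¹' B) = M.natSol hX x ⁻¹' (proj Z ⁻¹' B) := by
    intro B
    ext u
    simp only [Set.mem_preimage, context, M.proj_natSol_eq_proj_obs hX x hZ.not_desc]
  refine ⟨F, hF, fun B hBm => ⟨?_, ?_⟩⟩
  · rw [Set.preimage_inter, ← hB, ← hA']
    exact hFB _ (measurable_fst hBm)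
  · rw [← Set.inter_assoc, Set.preimage_inter, Set.preimage_inter, ← hB, ← hA', ← hB₀',
      ← Set.preimage_inter]
    exact hFB _ (hB₀.inter (measurable_fst hBm))

/-- The backdoor adjustment for an arbitrary set `Z`. -/
theorem doP_event_eq_lintegral (hM : IsMarkov G.Adj M.P) (hX : X.Finite) (hY : Y.Finite)
    (x : ∀ v : X, S v.1.1) (hZ : Backdoor G.Adj X Y Z) (y : ∀ v : Y, S v.1.1)
    (hac : M.P.map (proj Z) ≪ M.P[|event x].map (proj Z)) :
    M.doP hX x (event y) =
      ∫⁻ z, condDistrib (proj Y) (proj Z) M.P[|event x] z {y} ∂(M.P.map (proj Z)) := by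
  have := hY.to_subtype
  obtain ⟨F, hF, hFB⟩ := M.exists_condProb_natSol hM hX x hZ y
  have hFZ : Measurable fun w : ∀ v : Vertex ι, S v.1 => F (proj Z w) :=
    hF.comp (measurable_proj Z)
  have hy : MeasurableSet ({y} : Set (∀ v : Y, S v.1.1)) := MeasurableSet.of_discrete
  -- On `X = x` natural and observed values coincide, so `F` and the regular conditional law have
  -- the same integral over every measurable set of valuations of `Z`.
  have hae : F =ᵐ[M.P[|event x].map (proj Z)]
      fun z => condDistrib (proj Y) (proj Z) M.P[|event x] z {y} := by
    refine ae_eq_of_forall_setLIntegral_eq_of_sigmaFinite hF (Kernel.measurable_coe _ hy)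
      fun B hB _ => ?_
    rw [setLIntegral_map hB hF (measurable_proj Z),
      setLIntegral_map hB (Kernel.measurable_coe _ hy) (measurable_proj Z),
      setLIntegral_preimage_condDistrib (measurable_proj Z) (measurable_proj Y).aemeasurable hy hB,
      cond_apply (measurableSet_event x), ProbabilityTheory.cond, Measure.restrict_smul, lintegral_smul_measure,
      Measure.restrict_restrict (measurable_proj Z hB), Set.inter_comm (proj Z ⁻¹' B), smul_eq_mul]
    congr 1
    have h1 : M.P (event x ∩ (proj Z ⁻¹' B ∩ event y)) = _ :=
      (M.P_event_inter hX x ((measurable_proj Z hB).inter (measurableSet_event y))).trans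
        (hFB B hB).2
    refine Eq.trans ?_ h1.symm
    rw [P, setLIntegral_map ((measurableSet_event x).inter (measurable_proj Z hB)) hFZ
      M.measurable_obs]
    refine setLIntegral_congr ?_
    filter_upwards [M.ae_solves] with u hu
    refine propext (and_congr (M.obs_mem_event_iff hX x hu) ?_)
    simp only [Set.mem_preimage, M.proj_natSol_eq_proj_obs hX x hZ.not_desc]
  -- Absolute continuity carries the identity from the law of `Z` given `X = x` to the law of `Z`
  -- itself; the first property of `F`, on the whole space, then gives the claim.
  rw [M.doP_event hX x hZ.disjoint_XY, ← lintegral_congr_ae (hac.ae_le hae),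
    M.map_P (measurable_proj Z), lintegral_map hF (M.measurable_proj_obs Z)]
  simpa using (hFB Set.univ .univ).1

end DSCM

end CausalTS

theorem mainTheorem6 {ι : Type*} [Finite ι] {S : ι → Type*} [∀ i, Nonempty (S i)]
    [∀ i, Countable (S i)] [∀ i, MeasurableSpace (S i)] [∀ i, DiscreteMeasurableSpace (S i)]
    (Gs : ι → ι → Prop) (G : CausalTS.FTCG ι) (hG : G ∈ CausalTS.candidates Gs)
    (M : CausalTS.DSCM G S)
    {X Y : Set (CausalTS.Vertex ι)} (hX : X.Finite) (hY : Y.Finite)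
    (x : ∀ v : X, S v.1.1) (y : ∀ v : Y, S v.1.1)
    (Z : Set (CausalTS.Vertex ι)) (hZ : CausalTS.Backdoor G.Adj X Y Z) :
    -- finite `Z`: the sum over all valuations of `Z`
    (Z.Finite →
      (∀ z : ∀ v : Z, S v.1.1, M.P (CausalTS.event z) ≠ 0 →
        M.P (CausalTS.event x ∩ CausalTS.event z) ≠ 0) →
      M.doP hX x (CausalTS.event y) =
        ∑' z : ∀ v : Z, S v.1.1,
          M.P[CausalTS.event y | CausalTS.event x ∩ CausalTS.event z] *
            M.P (CausalTS.event z)) ∧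
    -- arbitrary `Z`: the sum is the integral of `P(y | x, z)` with respect to the law of `Z`
    (CausalTS.IsMarkov G.Adj M.P →
      M.P.map (CausalTS.proj Z) ≪ M.P[|CausalTS.event x].map (CausalTS.proj Z) →
      M.doP hX x (CausalTS.event y) =
        ∫⁻ z, condDistrib (CausalTS.proj Y) (CausalTS.proj Z) M.P[|CausalTS.event x] z {y}
          ∂(M.P.map (CausalTS.proj Z))) := by
  exact ⟨fun hZf hpos => M.doP_event_eq_tsum hX x hZ hZf y hpos,
    fun hM hac => M.doP_event_eq_lintegral hM hX hY x hZ y hac⟩
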